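/- **Setting.** Consider a constrained Markov decision process with countable state space $\mathcal S$, countable action space $\mathcal A$, transition probabilities $P(\cdot\mid s,a)$, discount rate $\gamma\in(0,1)$, initial distribution $\mu_0$, cost $c(s,a)$, auxiliary costs $d_1,\dots,d_K$ and thresholds $q\in\mathbb R^K$. A stationary policy $\pi$ assigns to each state $s$ a probability distribution $\pi(\cdot\mid s)$ on $\mathcal A$; a mixing policy is a probability measure on the set $\Pi_S$ of stationary policies, from which a policy is drawn once and then executed forever; $\mathcal M(\Pi_S)$ is the set of mixing policies. Put $$C(\pi)=(1-\gamma)\,\mathbb E^\pi_{s_0\sim\mu_0}\Big[\sum_{t\ge0}\gamma^t c(s_t,a_t)\Big],\qquad D_k(\pi)=(1-\gamma)\,\mathbb E^\pi_{s_0\sim\mu_0}\Big[\sum_{t\ge0}\gamma^t d_k(s_t,a_t)\Big],$$ $D=(D_1,\dots,D_K)$, $L(\pi,\lambda)=C(\pi)+\sum_k\lambda_k(D_k(\pi)-q_k)$, $c^\lambda=c+\sum_k\lambda_k(d_k-q_k)$ and $$Q^{\pi,\lambda}(s,a)=(1-\gamma)\,\mathbb E^\pi\Big[\sum_{t\ge0}\gamma^t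 c^\lambda(s_t,a_t)\,\Big|\,s_0=s,\ a_0=a\Big].$$ Let $\pi^*$ minimize $C$ over $\{\pi\in\mathcal M(\Pi_S):D(\pi)\le q\}$ and let $\lambda^*$ maximize $\lambda\mapsto\inf_{\pi\in\mathcal M(\Pi_S)}L(\pi,\lambda)$ over $\lambda\ge0$. Let $M\ge\|\lambda^*\|$, $r>0$ and $\Lambda_M=\{\lambda\in\mathbb R^K_+:\|\lambda\|\le M+r\}$ (Euclidean norm). Given step sizes $\eta_m>0$, a stationary policy $\pi_0$ and $\lambda_0\in\Lambda_M$, let $$\lambda_{m+1}=\mathrm{Proj}_{\Lambda_M}\big(\lambda_m+\eta_m(D(\pi_m)-q)\big),\qquad \pi_{m+1}(\cdot\mid s)\propto\pi_m(\cdot\mid s)\exp\big(-\eta_mQ^{\pi_m,\lambda_m}(s,\cdot)\big),$$ and let $\bar\pi_T$ be the mixing policy that executes $\pi_m$, $0\le m<T$, with probability $\eta_m/\sum_{j<T}\eta_j$. Let $\nu^{\pi^*}(s,a)=(1-\gamma)\sum_t\gamma^tP^{\pi^*}_{s_0\sim\mu_0}(s_t=s,a_t=a)$ be the occupation measure of $\pi^*$,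 $\nu_s^{\pi^*}(s)=\sum_a\nu^{\pi^*}(s,a)$, $\tilde\pi^*(a\mid s)=\nu^{\pi^*}(s,a)/\nu_s^{\pi^*}(s)$, and $$\Phi=\sum_s\nu_s^{\pi^*}(s)\,\mathrm{KL}\big(\tilde\pi^*(\cdot\mid s)\,\|\,\pi_0(\cdot\mid s)\big),\qquad R^2=\max_{\lambda\in\Lambda_M}\|\lambda-\lambda_0\|^2.$$ **Theorem.** Assume that (i) there is a constant $W$ with $c(s,a)>W$ and $d_k(s,a)>W$ for all $s,a,k$; (ii) there is a mixing policy $\tilde\pi$ with $D_k(\tilde\pi)<q_k$ for all $k$; (iii) there is $G>0$ such that for all $\lambda\in\Lambda_M$ and $\pi\in\mathcal M(\Pi_S)$ one has $\|D(\pi)-q\|\le G$ and $\sup_{s,a}|Q^{\pi,\lambda}(s,a)|\le G$ (all these expectations being finite); and that $\Phi<\infty$ (otherwise the bounds below are void). (a) If $\eta_m=\Theta(1/\sqrt m)$, then there are constants $\kappa_1,\kappa_2>0$, depending only on the step sizes, such that for all $T\ge2$ $$\big\|[D(\bar\pi_T)-q]^+\big\|\le\Big(R^2+\tfrac58G^2\kappa_2\log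 T+\Phi\Big)\frac1{2r(1-\gamma)\kappa_1\sqrt T},$$ $$C(\bar\pi_T)-L(\pi^*,\lambda^*)\le\Big(\tfrac58G^2\kappa_2\log T+\Phi+\tfrac12\|\lambda_0\|^2\Big)\frac1{(1-\gamma)\kappa_1\sqrt T},$$ $$C(\bar\pi_T)-L(\pi^*,\lambda^*)\ge-\|\lambda^*\|\Big(R^2+\tfrac58G^2\kappa_2\log T+\Phi\Big)\frac1{2r(1-\gamma)\kappa_1\sqrt T};$$ in particular both $\|[D(\bar\pi_T)-q]^+\|$ and $|C(\bar\pi_T)-L(\pi^*,\lambda^*)|$ are $O(\log T/\sqrt T)$. (b) If $\eta_m=\eta>0$ for all $m$, then for all $T\ge1$ $$\big\|[D(\bar\pi_T)-q]^+\big\|\le\Big(R^2+\frac{2\Phi}{1-\gamma}\Big)\frac1{2rT\eta}+\Big(1+\frac1{1-\gamma}\Big)\frac{G^2\eta}{2r},$$ $$C(\bar\pi_T)-L(\pi^*,\lambda^*)\le\Big(\frac{\Phi}{1-\gamma}+\frac{\|\lambda_0\|^2}2\Big)\frac1{T\eta}+\Big(\frac12+\frac1{2(1-\gamma)}\Big)G^2\eta,$$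 $$C(\bar\pi_T)-L(\pi^*,\lambda^*)\ge-\|\lambda^*\|\left[\Big(R^2+\frac{2\Phi}{1-\gamma}\Big)\frac1{2rT\eta}+\Big(1+\frac1{1-\gamma}\Big)\frac{G^2\eta}{2r}\right];$$ in particular both quantities are $O(1/(\eta T)+\eta)$. -/

import Mathlib

open MeasureTheory ProbabilityTheory Filter
open scoped ENNReal

/-- A constrained Markov decision process with countable state space `S`, countable action space
`A` and `K` auxiliary costs: transition kernel `P`, discount rate `γ ∈ (0,1)`, initial
distribution `μ₀`, cost `c`, auxiliary costs `d k` and thresholds `q k`. -/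
structure CMDP (S A : Type*) [MeasurableSpace S] [MeasurableSpace A] (K : ℕ) where
  P : Kernel (S × A) S
  markov : IsMarkovKernel P
  γ : ℝ
  γ_pos : 0 < γ
  γ_lt_one : γ < 1
  μ₀ : ProbabilityMeasure S
  c : S → A → ℝ
  d : Fin K → S → A → ℝ
  q : EuclideanSpace ℝ (Fin K)

/-- Stationary (randomized) policies: `π s` is the law of the action taken in state `s`.
The space of stationary policies carries the product `σ`-algebra, so that a mixing stationary
policy is a probability measure on `StationaryPolicy S A`. -/
abbrev StationaryPolicy (S A : Type*) [MeasurableSpace A] := S → ProbabilityMeasure A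

namespace CMDP

noncomputable section

variable {S A : Type*} [Countable S] [MeasurableSpace S] [MeasurableSingletonClass S]
  [MeasurableSpace A] {K : ℕ}

/-- A stationary policy as a Markov kernel. -/
def policyKernel (π : StationaryPolicy S A) : Kernel S A :=
  Kernel.ofFunOfCountable fun s => (π s : Measure A)

/-- The law of `(s_t, a_t)` under the stationary policy `π` when `(s_0, a_0)` has law `ν`:
`s_{t+1} ∼ P(· | s_t, a_t)` and `a_{t+1} ∼ π(· | s_{t+1})`. -/
def law (X : CMDP S A K) (π : StationaryPolicy S A) (ν : Measure (S × A)) :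
    ℕ → Measure (S × A)
  | 0 => ν
  | t + 1 => ((X.law π ν t).bind X.P) ⊗ₘ policyKernel π

/-- The law of `(s_0, a_0)` when `s_0 ∼ μ₀` and `a_0 ∼ π(· | s_0)`. -/
def initLaw (X : CMDP S A K) (π : StationaryPolicy S A) : Measure (S × A) :=
  (X.μ₀ : Measure S) ⊗ₘ policyKernel π

/-- `(1 - γ) E[∑ₜ γ^t f(s_t, a_t)]` under `π`, when `(s_0, a_0)` has law `ν`. -/
def discounted (X : CMDP S A K) (f : S → A → ℝ) (π : StationaryPolicy S A)
    (ν : Measure (S × A)) : ℝ :=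
  (1 - X.γ) * ∑' t : ℕ, X.γ ^ t * ∫ x, f x.1 x.2 ∂(X.law π ν t)

/-- The discounted cost is well defined and finite: `E[∑ₜ γ^t |f(s_t, a_t)|] < ∞`. -/
def FiniteDiscounted (X : CMDP S A K) (f : S → A → ℝ) (π : StationaryPolicy S A)
    (ν : Measure (S × A)) : Prop :=
  (∀ t, Integrable (fun x : S × A => f x.1 x.2) (X.law π ν t)) ∧
    Summable fun t : ℕ => X.γ ^ t * ∫ x, |f x.1 x.2| ∂(X.law π ν t)

/-- `C(π)` for a mixing policy `ρ` (a measure on stationary policies). -/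
def cost (X : CMDP S A K) (ρ : Measure (StationaryPolicy S A)) : ℝ :=
  ∫ π, X.discounted X.c π (X.initLaw π) ∂ρ

/-- The vector `D(π) = (D_1(π), …, D_K(π))` for a mixing policy `ρ`. -/
def auxCost (X : CMDP S A K) (ρ : Measure (StationaryPolicy S A)) : EuclideanSpace ℝ (Fin K) :=
  WithLp.toLp 2 fun k => ∫ π, X.discounted (X.d k) π (X.initLaw π) ∂ρ

/-- The Lagrangian `L(π, l) = C(π) + ∑ₖ l_k (D_k(π) - q_k)`. -/
def lagrangian (X : CMDP S A K) (ρ : Measure (StationaryPolicy S A))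
    (l : EuclideanSpace ℝ (Fin K)) : ℝ :=
  X.cost ρ + ∑ k, l k * (X.auxCost ρ k - X.q k)

/-- The modified instantaneous cost `c^l(s,a) = c(s,a) + ∑ₖ l_k (d_k(s,a) - q_k)`. -/
def modCost (X : CMDP S A K) (l : EuclideanSpace ℝ (Fin K)) (s : S) (a : A) : ℝ :=
  X.c s a + ∑ k, l k * (X.d k s a - X.q k)

/-- The `Q`-function `Q^{π,l}(s,a)` of a stationary policy. -/
def qFun (X : CMDP S A K) (π : StationaryPolicy S A) (l : EuclideanSpace ℝ (Fin K))
    (s : S) (a : A) : ℝ :=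
  X.discounted (X.modCost l) π (Measure.dirac (s, a))

/-- The `Q`-function of a mixing policy (the initial randomization is averaged out). -/
def qFunMix (X : CMDP S A K) (ρ : Measure (StationaryPolicy S A))
    (l : EuclideanSpace ℝ (Fin K)) (s : S) (a : A) : ℝ :=
  ∫ π, X.qFun π l s a ∂ρ

/-- The occupation measure of a stationary policy,
`ν^π = (1 - γ) ∑ₜ γ^t P^π((s_t, a_t) ∈ ·)` with `s_0 ∼ μ₀`. -/
def occ (X : CMDP S A K) (π : StationaryPolicy S A) : Measure (S × A) :=
  Measure.sum fun t : ℕ => ENNReal.ofReal ((1 - X.γ) * X.γ ^ t) • X.law π (X.initLaw π) t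

/-- The occupation measure of a mixing policy. -/
def occMix (X : CMDP S A K) (ρ : Measure (StationaryPolicy S A)) : Measure (S × A) :=
  ρ.bind X.occ

/-- The stationary policy with occupation measure `ν`: `a ↦ ν(s,a) / ∑_{a'} ν(s,a')`
(the zero measure at the states `s` that `ν` does not charge). -/
def inducedPolicy (ν : Measure (S × A)) (s : S) : Measure A :=
  (cond ν (Prod.fst ⁻¹' {s})).map Prod.snd

/-- `Φ^ρ(ρ ‖ π₀)`: the Kullback-Leibler divergence from `π₀(· | s)` to the stationary policy
equivalent to the mixing policy `ρ`, averaged over the state occupation measure of `ρ`. -/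
def potential (X : CMDP S A K) (ρ : Measure (StationaryPolicy S A))
    (π₀ : StationaryPolicy S A) : ℝ≥0∞ :=
  ∫⁻ s, InformationTheory.klDiv (inducedPolicy (X.occMix ρ) s) (π₀ s : Measure A)
    ∂(X.occMix ρ).fst

/-- `ρ` is an optimal solution of the primal problem over mixing stationary policies:
minimize `C(ρ)` subject to `D(ρ) ≤ q`. -/
def IsPrimalOptimal (X : CMDP S A K) (ρ : Measure (StationaryPolicy S A)) : Prop :=
  IsProbabilityMeasure ρ ∧ (∀ k, X.auxCost ρ k ≤ X.q k) ∧
    ∀ ρ' : Measure (StationaryPolicy S A), IsProbabilityMeasure ρ' →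
      (∀ k, X.auxCost ρ' k ≤ X.q k) → X.cost ρ ≤ X.cost ρ'

/-- The dual function `l ↦ inf_ρ L(ρ, l)`, the infimum being over mixing stationary policies. -/
def dualFun (X : CMDP S A K) (l : EuclideanSpace ℝ (Fin K)) : EReal :=
  ⨅ ρ : ProbabilityMeasure (StationaryPolicy S A), ((X.lagrangian (ρ : Measure _) l : ℝ) : EReal)

/-- `l` maximizes the dual function over the nonnegative orthant. -/
def IsDualOptimal (X : CMDP S A K) (l : EuclideanSpace ℝ (Fin K)) : Prop :=
  (∀ k, 0 ≤ l k) ∧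
    ∀ l' : EuclideanSpace ℝ (Fin K), (∀ k, 0 ≤ l' k) → X.dualFun l' ≤ X.dualFun l

/-- All instantaneous costs are uniformly bounded from below. -/
def CostsBoundedBelow (X : CMDP S A K) : Prop :=
  ∃ W : ℝ, ∀ s a, W < X.c s a ∧ ∀ k, W < X.d k s a

/-- Slater's condition. -/
def Slater (X : CMDP S A K) : Prop :=
  ∃ ρ : Measure (StationaryPolicy S A), IsProbabilityMeasure ρ ∧ ∀ k, X.auxCost ρ k < X.q k

/-- The projection domain `{l ≥ 0 : ‖l‖ ≤ M + r}`. -/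
def dualDomain (K : ℕ) (M r : ℝ) : Set (EuclideanSpace ℝ (Fin K)) :=
  {l | (∀ k, 0 ≤ l k) ∧ ‖l‖ ≤ M + r}

/-- Subgradients `∂_l L(ρ, l) = D(ρ) - q` and `Q`-functions are (finite and) bounded by `G` for
multipliers in the set `Λ` and mixing stationary policies. -/
def BoundedSubgradient (X : CMDP S A K) (Λ : Set (EuclideanSpace ℝ (Fin K))) (G : ℝ) : Prop :=
  ∀ l ∈ Λ,
    (∀ (π : StationaryPolicy S A) (s : S) (a : A),
      X.FiniteDiscounted (X.modCost l) π (Measure.dirac (s, a))) ∧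
    ∀ ρ : Measure (StationaryPolicy S A), IsProbabilityMeasure ρ →
      ‖X.auxCost ρ - X.q‖ ≤ G ∧ ∀ s a, |X.qFunMix ρ l s a| ≤ G

/-- The sequences `(π_m, l_m)` are generated by the primal-dual algorithm with projection
domain `Λ` and step sizes `η`: `l_{m+1}` is the Euclidean projection onto `Λ` of
`l_m + η_m (D(π_m) - q)`, and `π_{m+1}(· | s) ∝ π_m(· | s) exp(-η_m Q^{π_m,l_m}(s, ·))`
(`Measure.tilted` is the normalized exponential reweighting). -/
structure IsPrimalDualRun (X : CMDP S A K) (Λ : Set (EuclideanSpace ℝ (Fin K))) (η : ℕ → ℝ)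
    (π : ℕ → StationaryPolicy S A) (l : ℕ → EuclideanSpace ℝ (Fin K)) : Prop where
  init_mem : l 0 ∈ Λ
  dual_mem : ∀ m, l (m + 1) ∈ Λ
  dual_proj : ∀ m, ∀ z ∈ Λ,
    ‖(l m + η m • (X.auxCost (Measure.dirac (π m)) - X.q)) - l (m + 1)‖ ≤
      ‖(l m + η m • (X.auxCost (Measure.dirac (π m)) - X.q)) - z‖
  policy_step : ∀ m s, (π (m + 1) s : Measure A) =
    (π m s : Measure A).tilted fun a => -(η m * X.qFun (π m) (l m) s a)

/-- The output of the algorithm: the mixing policy that executes `π_m`, `0 ≤ m < T`, with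
probability `η_m / ∑_{j<T} η_j`. -/
def output (η : ℕ → ℝ) (π : ℕ → StationaryPolicy S A) (T : ℕ) :
    Measure (StationaryPolicy S A) :=
  ∑ m ∈ Finset.range T,
    ENNReal.ofReal (η m / ∑ j ∈ Finset.range T, η j) • Measure.dirac (π m)

/-- The constraint violation `‖[D(ρ) - q]^+‖`. -/
def violation (X : CMDP S A K) (ρ : Measure (StationaryPolicy S A)) : ℝ :=
  ‖(WithLp.toLp 2 fun k => max (X.auxCost ρ k - X.q k) 0 : EuclideanSpace ℝ (Fin K))‖

/-- `max_{l ∈ Λ} ‖l - l₀‖²`. -/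
def sqRadius (Λ : Set (EuclideanSpace ℝ (Fin K))) (l₀ : EuclideanSpace ℝ (Fin K)) : ℝ :=
  sSup ((fun l => ‖l - l₀‖ ^ 2) '' Λ)

/-- The standing assumptions: costs bounded below, Slater's condition, subgradients bounded by
`G` on the domain `{l ≥ 0 : ‖l‖ ≤ M + r}`, a primal optimal `ρs`, a dual optimal `ls` with
`‖ls‖ ≤ M`, and sequences `(π_m, l_m)` generated by the algorithm with step sizes `η` from an
initial policy at finite divergence (if `Φ = ∞`, there is nothing to bound). -/
structure Setting (X : CMDP S A K) (M r G : ℝ) (ρs : Measure (StationaryPolicy S A))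
    (ls : EuclideanSpace ℝ (Fin K)) (η : ℕ → ℝ) (π : ℕ → StationaryPolicy S A)
    (l : ℕ → EuclideanSpace ℝ (Fin K)) : Prop where
  bounded_below : X.CostsBoundedBelow
  slater : X.Slater
  r_pos : 0 < r
  G_pos : 0 < G
  bounded_subgradient : X.BoundedSubgradient (dualDomain K M r) G
  primal_optimal : X.IsPrimalOptimal ρs
  dual_optimal : X.IsDualOptimal ls
  norm_le : ‖ls‖ ≤ M
  run : X.IsPrimalDualRun (dualDomain K M r) η π l
  finite_potential : X.potential ρs (π 0) ≠ ∞

end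

end CMDP

/-!
The standing assumptions make all instantaneous costs bounded, since the `Q`-function dominates
the cost of the first step. The values `(C(ρ), D(ρ) - q)` of the mixing policies then form a convex
set, and Slater's condition yields strong duality: `(π*, λ*)` is a saddle point of `L`.

The algorithm plays a no-regret strategy on each side. The multipliers follow projected subgradient
ascent, whose regret telescopes. In each state the policies follow exponential weights with loss
`Q^{π_m, λ_m}(s, ·)`; averaging the regret of the comparison policy over its state occupation
measure, the performance difference identity turns it into `(1 - γ)` times the regret in `L`, with
`Φ` as initial distance. Adding the two regrets bounds `L(π̄_T, λ) - L(π*, λ*)` for every `λ` in the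
domain: `λ = 0` bounds the cost, and `λ = λ* + r [D - q]^+ / ‖[D - q]^+‖` bounds the violation.
-/

section LagrangeMultiplier

variable {ι : Type*} [Fintype ι]

theorem exists_nonneg_ne_zero_forall_sum_mul_nonneg {W : Set (ι → ℝ)} (hW : Convex ℝ W)
    (hne : W.Nonempty) (hneg : ∀ w ∈ W, ∃ i, 0 ≤ w i) :
    ∃ y : ι → ℝ, 0 ≤ y ∧ y ≠ 0 ∧ ∀ w ∈ W, 0 ≤ ∑ i, y i * w i := by
  classical
  let O : Set (ι → ℝ) := Set.univ.pi fun _ => Set.Iio 0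
  have hdisj : Disjoint O W := Set.disjoint_left.2 fun w hwO hwW =>
    have ⟨i, hi⟩ := hneg w hwW
    hi.not_gt (hwO i trivial)
  obtain ⟨f, u, hfO, hfW⟩ := geometric_hahn_banach_open (convex_pi fun _ _ => convex_Iio 0)
    (isOpen_set_pi Set.finite_univ fun _ _ => isOpen_Iio) hW hdisj
  have hf_le : ∀ a ≤ 0, f a ≤ u := fun a ha => by
    have hmem : a ∈ closure O := by
      simp only [O, closure_pi_set, closure_Iio]
      exact fun i _ => ha i
    exact closure_minimal (fun b hb => (hfO b hb).le)
      (isClosed_le f.continuous continuous_const) hmem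
  have hu : 0 ≤ u := by simpa using hf_le 0 le_rfl
  let y : ι → ℝ := fun i => f (Pi.single i 1)
  have hf_eq : ∀ w, f w = ∑ i, y i * w i := fun w => by
    simp only [y, mul_comm _ (w _), ← smul_eq_mul (w _), ← map_smul, ← map_sum,
      ← pi_eq_sum_univ']
  refine ⟨y, fun i => ?_, fun hy => ?_, fun w hw => hf_eq w ▸ hu.trans (hfW w hw)⟩
  · by_contra! hi
    have ht : 0 ≤ (u + 1) / -y i := div_nonneg (by linarith) (neg_nonneg.2 hi.le)
    have h := hf_le (-((u + 1) / -y i) • Pi.single i 1)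
      (smul_nonpos_of_nonpos_of_nonneg (neg_nonpos.2 ht) (Pi.single_nonneg.2 zero_le_one))
    rw [map_smul, smul_eq_mul, div_neg, neg_neg, div_mul_cancel₀ _ hi.ne] at h
    linarith
  · obtain ⟨w, hw⟩ := hne
    have h := (hfO (-1) fun i _ => by simp).trans_le (hfW w hw)
    simp [hf_eq, hy] at h

variable {E : Type*} [AddCommGroup E] [Module ℝ E] {s : Set E}

theorem exists_nonneg_ne_zero_forall_sum_mul_convexOn_nonneg {g : ι → E → ℝ}
    (hne : s.Nonempty) (hg : ∀ i, ConvexOn ℝ s (g i))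
    (hneg : ∀ x ∈ s, ∃ i, 0 ≤ g i x) :
    ∃ y : ι → ℝ, 0 ≤ y ∧ y ≠ 0 ∧ ∀ x ∈ s, 0 ≤ ∑ i, y i * g i x := by
  obtain ⟨x₀, hx₀⟩ := hne
  obtain ⟨i₀, -⟩ := hneg x₀ hx₀
  let W : Set (ι → ℝ) := {w | ∃ x ∈ s, ∀ i, g i x ≤ w i}
  have hW : Convex ℝ W := by
    rintro w ⟨x, hx, hxw⟩ w' ⟨x', hx', hxw'⟩ a b ha hb hab
    refine ⟨a • x + b • x', (hg i₀).1 hx hx' ha hb hab,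
      fun i => ((hg i).2 hx hx' ha hb hab).trans ?_⟩
    exact add_le_add (smul_le_smul_of_nonneg_left (hxw i) ha)
      (smul_le_smul_of_nonneg_left (hxw' i) hb)
  have hmem : ∀ x ∈ s, (fun i => g i x) ∈ W := fun x hx => ⟨x, hx, fun _ => le_rfl⟩
  obtain ⟨y, hy0, hy, hyW⟩ := exists_nonneg_ne_zero_forall_sum_mul_nonneg hW ⟨_, hmem x₀ hx₀⟩
    fun w ⟨x, hx, hxw⟩ => (hneg x hx).imp fun i hi => hi.trans (hxw i)
  exact ⟨y, hy0, hy, fun x hx => hyW _ (hmem x hx)⟩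

theorem exists_lagrange_multiplier {f : E → ℝ} {g : ι → E → ℝ} (hf : ConvexOn ℝ s f)
    (hg : ∀ i, ConvexOn ℝ s (g i)) (hslater : ∃ x ∈ s, ∀ i, g i x < 0) {p : ℝ}
    (hp : ∀ x ∈ s, (∀ i, g i x ≤ 0) → p ≤ f x) :
    ∃ y : ι → ℝ, 0 ≤ y ∧ ∀ x ∈ s, p ≤ f x + ∑ i, y i * g i x := by
  obtain ⟨x₀, hx₀, hx₀g⟩ := hslater
  have hconv : ∀ o : Option ι, ConvexOn ℝ s fun x => o.elim (f x - p) (g · x)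
    | none => hf.sub (concaveOn_const p hf.1)
    | some i => hg i
  have hneg : ∀ x ∈ s, ∃ o : Option ι, 0 ≤ o.elim (f x - p) (g · x) := fun x hx => by
    by_contra! h
    exact (h none).not_ge (sub_nonneg.2 (hp x hx fun i => (h (some i)).le))
  obtain ⟨y, hy0, hyne, hy⟩ :=
    exists_nonneg_ne_zero_forall_sum_mul_convexOn_nonneg ⟨x₀, hx₀⟩ hconv hneg
  simp only [Fintype.sum_option, Option.elim] at hy
  have hnone : 0 < y none := by
    refine (hy0 none).lt_of_ne' fun h0 => hyne ?_
    have hterm : ∀ i, y (some i) * g i x₀ ≤ 0 := fun i =>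
      mul_nonpos_of_nonneg_of_nonpos (hy0 _) (hx₀g i).le
    have hsum : ∑ i, y (some i) * g i x₀ = 0 :=
      (Finset.sum_nonpos fun i _ => hterm i).antisymm (by simpa [h0] using hy x₀ hx₀)
    have hzero := (Finset.sum_eq_zero_iff_of_nonpos fun i _ => hterm i).1 hsum
    funext o
    cases o with
    | none => exact h0
    | some i => exact (mul_eq_zero.1 (hzero i (Finset.mem_univ i))).resolve_right (hx₀g i).ne
  refine ⟨fun i => y (some i) / y none, fun i => div_nonneg (hy0 _) hnone.le, fun x hx => ?_⟩
  have hdiv : ∑ i, y (some i) / y none * g i x = (∑ i, y (some i) * g i x) / y none := by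
    rw [Finset.sum_div]
    exact Finset.sum_congr rfl fun i _ => div_mul_eq_mul_div _ _ _
  rw [hdiv, ← sub_le_iff_le_add', le_div_iff₀ hnone]
  linarith [hy x hx]

end LagrangeMultiplier

section MirrorDescent

open InformationTheory

variable {α : Type*} [MeasurableSpace α] {μ ν : Measure α}

theorem klDiv_tilted_right_ne_top [IsFiniteMeasure μ] [SigmaFinite ν] {f : α → ℝ}
    (h : klDiv μ ν ≠ ∞) (hfμ : Integrable f μ) (hfν : Integrable (fun x => Real.exp (f x)) ν) :
    klDiv μ (ν.tilted f) ≠ ∞ := by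
  obtain ⟨hac, hllr⟩ := klDiv_ne_top_iff.1 h
  exact klDiv_ne_top (hac.trans (absolutelyContinuous_tilted hfν))
    (integrable_llr_tilted_right hac hfμ hllr hfν)

theorem toReal_klDiv_tilted_right [IsProbabilityMeasure μ] [IsProbabilityMeasure ν] {f : α → ℝ}
    (h : klDiv μ ν ≠ ∞) (hfμ : Integrable f μ) (hfν : Integrable (fun x => Real.exp (f x)) ν) :
    (klDiv μ (ν.tilted f)).toReal =
      (klDiv μ ν).toReal - ∫ x, f x ∂μ + Real.log (∫ x, Real.exp (f x) ∂ν) := by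
  obtain ⟨hac, hllr⟩ := klDiv_ne_top_iff.1 h
  have := isProbabilityMeasure_tilted hfν
  rw [toReal_klDiv_of_measure_eq (hac.trans (absolutelyContinuous_tilted hfν)) (by simp),
    toReal_klDiv_of_measure_eq hac (by simp), integral_llr_tilted_right hac hfμ hfν hllr]

theorem log_integral_exp_mul_le [IsProbabilityMeasure ν] {f : α → ℝ} (hf : Measurable f) {G : ℝ}
    (hG : ∀ x, |f x| ≤ G) (t : ℝ) :
    Real.log (∫ x, Real.exp (t * f x) ∂ν) ≤ t * ∫ x, f x ∂ν + G ^ 2 / 2 * t ^ 2 := by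
  have hmem : ∀ᵐ x ∂ν, f x ∈ Set.Icc (-G) G := ae_of_all _ fun x => abs_le.1 (hG x)
  have hexp : Integrable (fun x => Real.exp (t * f x)) ν :=
    integrable_exp_mul_of_mem_Icc hf.aemeasurable hmem
  have hcgf : cgf (fun x => f x - ∫ y, f y ∂ν) ν t =
      Real.log (∫ x, Real.exp (t * f x) ∂ν) - t * ∫ x, f x ∂ν := by
    simp only [cgf, mgf, mul_sub, Real.exp_sub]
    rw [integral_div, Real.log_div (integral_exp_pos hexp).ne' (Real.exp_pos _).ne', Real.log_exp]
  have hproxy : (((‖G - -G‖₊ / 2) ^ 2 : NNReal) : ℝ) = G ^ 2 := by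
    push_cast
    rw [Real.norm_eq_abs, div_pow, sq_abs]
    ring
  have hsub := (hasSubgaussianMGF_of_mem_Icc hf.aemeasurable hmem).cgf_le t
  rw [hcgf, hproxy] at hsub
  linarith

theorem sum_mul_integral_sub_integral_le_of_tilted [IsProbabilityMeasure μ] {ν : ℕ → Measure α}
    [∀ m, IsProbabilityMeasure (ν m)] {f : ℕ → α → ℝ} (hf : ∀ m, Measurable (f m)) {G : ℝ}
    (hG : ∀ m x, |f m x| ≤ G) {η : ℕ → ℝ}
    (hν : ∀ m, ν (m + 1) = (ν m).tilted fun x => -(η m * f m x)) (h0 : klDiv μ (ν 0) ≠ ∞) (T : ℕ) :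
    ∑ m ∈ Finset.range T, η m * (∫ x, f m x ∂ν m - ∫ x, f m x ∂μ) ≤
      (klDiv μ (ν 0)).toReal + G ^ 2 / 2 * ∑ m ∈ Finset.range T, η m ^ 2 := by
  have hμ : ∀ m, Integrable (fun x => -(η m * f m x)) μ := fun m =>
    ((Integrable.of_bound (hf m).aestronglyMeasurable G (ae_of_all _ (hG m))).const_mul _).neg
  have hexp : ∀ m, Integrable (fun x => Real.exp (-(η m * f m x))) (ν m) := fun m => by
    simpa only [neg_mul] using integrable_exp_mul_of_mem_Icc (t := -η m) (hf m).aemeasurable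
      (ae_of_all (ν m) fun x => abs_le.1 (hG m x))
  have hfin : ∀ m, klDiv μ (ν m) ≠ ∞ := fun m => by
    induction m with
    | zero => exact h0
    | succ m ih => exact hν m ▸ klDiv_tilted_right_ne_top ih (hμ m) (hexp m)
  have hstep : ∀ m, η m * (∫ x, f m x ∂ν m - ∫ x, f m x ∂μ) ≤
      (klDiv μ (ν m)).toReal - (klDiv μ (ν (m + 1))).toReal + G ^ 2 / 2 * η m ^ 2 := fun m => by
    have hlog := log_integral_exp_mul_le (ν := ν m) (hf m) (hG m) (-η m)
    simp only [neg_mul, neg_sq] at hlog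
    rw [hν m, toReal_klDiv_tilted_right (hfin m) (hμ m) (hexp m), integral_neg, integral_const_mul]
    linarith
  calc ∑ m ∈ Finset.range T, η m * (∫ x, f m x ∂ν m - ∫ x, f m x ∂μ)
      ≤ ∑ m ∈ Finset.range T,
          ((klDiv μ (ν m)).toReal - (klDiv μ (ν (m + 1))).toReal + G ^ 2 / 2 * η m ^ 2) :=
        Finset.sum_le_sum fun m _ => hstep m
    _ = (klDiv μ (ν 0)).toReal - (klDiv μ (ν T)).toReal +
          G ^ 2 / 2 * ∑ m ∈ Finset.range T, η m ^ 2 := by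
        rw [Finset.sum_add_distrib, Finset.sum_range_sub', Finset.mul_sum]
    _ ≤ (klDiv μ (ν 0)).toReal + G ^ 2 / 2 * ∑ m ∈ Finset.range T, η m ^ 2 := by
        gcongr
        exact sub_le_self _ ENNReal.toReal_nonneg

end MirrorDescent

section ProjectedSubgradient

variable {E : Type*} [NormedAddCommGroup E] [InnerProductSpace ℝ E] {Λ : Set E}

theorem norm_sub_le_of_forall_norm_sub_le (hΛ : Convex ℝ Λ) {x p z : E} (hp : p ∈ Λ)
    (hmin : ∀ w ∈ Λ, ‖x - p‖ ≤ ‖x - w‖) (hz : z ∈ Λ) : ‖p - z‖ ≤ ‖x - z‖ := by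
  have : Nonempty Λ := ⟨⟨p, hp⟩⟩
  have hinf : ‖x - p‖ = ⨅ w : Λ, ‖x - w‖ :=
    (le_ciInf fun w : Λ => hmin w w.2).antisymm
      (ciInf_le ⟨0, Set.forall_mem_range.2 fun w : Λ => norm_nonneg (x - w)⟩ ⟨p, hp⟩)
  have hobtuse := (norm_eq_iInf_iff_real_inner_le_zero hΛ hp).1 hinf z hz
  refine (sq_le_sq₀ (norm_nonneg _) (norm_nonneg _)).1 ?_
  rw [← sub_sub_sub_cancel_right x z p, norm_sub_sq_real (x - p), norm_sub_rev p z]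
  linarith [sq_nonneg ‖x - p‖]

theorem sum_mul_inner_sub_le_of_projection (hΛ : Convex ℝ Λ) {g l : ℕ → E} {η : ℕ → ℝ} {G : ℝ}
    (hg : ∀ m, ‖g m‖ ≤ G) (hmem : ∀ m, l (m + 1) ∈ Λ)
    (hproj : ∀ m, ∀ z ∈ Λ, ‖l m + η m • g m - l (m + 1)‖ ≤ ‖l m + η m • g m - z‖)
    {y : E} (hy : y ∈ Λ) (T : ℕ) :
    ∑ m ∈ Finset.range T, η m * inner ℝ (g m) (y - l m) ≤
      ‖y - l 0‖ ^ 2 / 2 + G ^ 2 / 2 * ∑ m ∈ Finset.range T, η m ^ 2 := by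
  have hstep : ∀ m, η m * inner ℝ (g m) (y - l m) ≤
      ‖y - l m‖ ^ 2 / 2 - ‖y - l (m + 1)‖ ^ 2 / 2 + G ^ 2 / 2 * η m ^ 2 := fun m => by
    have hnonexp := pow_le_pow_left₀ (norm_nonneg _)
      (norm_sub_le_of_forall_norm_sub_le hΛ (hmem m) (hproj m) hy) 2
    rw [norm_sub_rev, norm_sub_rev _ y, ← sub_sub, norm_sub_sq_real (y - l m),
      real_inner_smul_right, norm_smul, mul_pow, Real.norm_eq_abs, sq_abs,
      real_inner_comm] at hnonexp
    have hgG : η m ^ 2 * ‖g m‖ ^ 2 ≤ η m ^ 2 * G ^ 2 := by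
      gcongr
      exact hg m
    linarith
  calc ∑ m ∈ Finset.range T, η m * inner ℝ (g m) (y - l m)
      ≤ ∑ m ∈ Finset.range T,
          (‖y - l m‖ ^ 2 / 2 - ‖y - l (m + 1)‖ ^ 2 / 2 + G ^ 2 / 2 * η m ^ 2) :=
        Finset.sum_le_sum fun m _ => hstep m
    _ = ‖y - l 0‖ ^ 2 / 2 - ‖y - l T‖ ^ 2 / 2 + G ^ 2 / 2 * ∑ m ∈ Finset.range T, η m ^ 2 := by
        rw [Finset.sum_add_distrib, Finset.sum_range_sub' fun m => ‖y - l m‖ ^ 2 / 2,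
          Finset.mul_sum]
    _ ≤ ‖y - l 0‖ ^ 2 / 2 + G ^ 2 / 2 * ∑ m ∈ Finset.range T, η m ^ 2 := by
        gcongr
        exact sub_le_self _ (by positivity)

end ProjectedSubgradient

section StepSizes

theorem one_div_sqrt_isTheta_one_div_sqrt_succ :
    (fun m : ℕ => 1 / √(m : ℝ)) =Θ[atTop] fun m : ℕ => 1 / √((m : ℝ) + 1) := by
  have hsqrt : (fun m : ℕ => √(m : ℝ)) =Θ[atTop] fun m : ℕ => √((m : ℝ) + 1) := by
    refine ⟨.of_norm_le fun m => ?_, .of_bound 2 ?_⟩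
    · rw [Real.norm_of_nonneg (Real.sqrt_nonneg _)]
      exact Real.sqrt_le_sqrt (by linarith)
    · filter_upwards [eventually_ge_atTop 1] with m hm
      have hm' : (1 : ℝ) ≤ m := mod_cast hm
      rw [Real.norm_of_nonneg (Real.sqrt_nonneg _), Real.norm_of_nonneg (Real.sqrt_nonneg _),
        Real.sqrt_le_left (by positivity), mul_pow, Real.sq_sqrt (by positivity)]
      linarith
  simpa only [one_div] using hsqrt.inv

theorem exists_mul_le_and_le_mul_of_isTheta {f g : ℕ → ℝ} (hf : ∀ m, 0 < f m)
    (hg : ∀ m, 0 < g m) (h : f =Θ[atTop] g) :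
    ∃ a > 0, ∃ b > 0, ∀ m, a * g m ≤ f m ∧ f m ≤ b * g m := by
  obtain ⟨b, hb, hfg⟩ := Asymptotics.bound_of_isBigO_nat_atTop h.1
  obtain ⟨a, ha, hgf⟩ := Asymptotics.bound_of_isBigO_nat_atTop h.2
  refine ⟨a⁻¹, inv_pos.2 ha, b, hb, fun m => ⟨?_, ?_⟩⟩
  · rw [inv_mul_le_iff₀ ha]
    simpa only [Real.norm_of_nonneg (hf m).le, Real.norm_of_nonneg (hg m).le] using hgf (hf m).ne'
  · simpa only [Real.norm_of_nonneg (hf m).le, Real.norm_of_nonneg (hg m).le] using hfg (hg m).ne'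

theorem sqrt_le_sum_one_div_sqrt (T : ℕ) :
    √(T : ℝ) ≤ ∑ m ∈ Finset.range T, 1 / √((m : ℝ) + 1) := by
  have hterm : ∀ m ∈ Finset.range T, 1 / √(T : ℝ) ≤ 1 / √((m : ℝ) + 1) := fun m hm => by
    gcongr
    exact_mod_cast Finset.mem_range.1 hm
  calc √(T : ℝ) = (Finset.range T).card • (1 / √(T : ℝ)) := by
        rw [Finset.card_range, nsmul_eq_mul, mul_one_div, Real.div_sqrt]
    _ ≤ ∑ m ∈ Finset.range T, 1 / √((m : ℝ) + 1) := Finset.card_nsmul_le_sum _ _ _ hterm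

theorem sum_sq_one_div_sqrt_le {T : ℕ} (hT : 2 ≤ T) :
    ∑ m ∈ Finset.range T, (1 / √((m : ℝ) + 1)) ^ 2 ≤ (1 / Real.log 2 + 1) * Real.log T := by
  have hharm : ∑ m ∈ Finset.range T, (1 / √((m : ℝ) + 1)) ^ 2 = (harmonic T : ℝ) := by
    push_cast [harmonic]
    refine Finset.sum_congr rfl fun m _ => ?_
    rw [div_pow, one_pow, one_div, Real.sq_sqrt (by positivity)]
  have hlog2 : 0 < Real.log 2 := Real.log_pos one_lt_two
  have hlogT : 1 ≤ Real.log T / Real.log 2 := by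
    rw [one_le_div hlog2]
    exact Real.log_le_log two_pos (mod_cast hT)
  calc ∑ m ∈ Finset.range T, (1 / √((m : ℝ) + 1)) ^ 2 ≤ 1 + Real.log T :=
        hharm ▸ harmonic_le_one_add_log T
    _ ≤ Real.log T / Real.log 2 + Real.log T := by gcongr
    _ = (1 / Real.log 2 + 1) * Real.log T := by ring

theorem exists_sum_bounds_of_isTheta_one_div_sqrt {η : ℕ → ℝ} (hpos : ∀ m, 0 < η m)
    (hη : η =Θ[atTop] fun m : ℕ => 1 / √(m : ℝ)) :
    ∃ κ₁ > 0, ∃ κ₂ > 0, ∀ T : ℕ, 2 ≤ T →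
      2 * (κ₁ * √(T : ℝ)) ≤ ∑ m ∈ Finset.range T, η m ∧
      ∑ m ∈ Finset.range T, η m ^ 2 ≤ 5 / 8 * (κ₂ * Real.log T) := by
  obtain ⟨a, ha, b, hb, hab⟩ := exists_mul_le_and_le_mul_of_isTheta hpos
    (fun m => by positivity) (hη.trans one_div_sqrt_isTheta_one_div_sqrt_succ)
  have : 0 < Real.log 2 := Real.log_pos one_lt_two
  refine ⟨a / 2, by positivity, 8 / 5 * (b ^ 2 * (1 / Real.log 2 + 1)), by positivity,
    fun T hT => ⟨?_, ?_⟩⟩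
  · calc 2 * (a / 2 * √(T : ℝ)) = a * √(T : ℝ) := by ring
      _ ≤ a * ∑ m ∈ Finset.range T, 1 / √((m : ℝ) + 1) := by
          gcongr
          exact sqrt_le_sum_one_div_sqrt T
      _ ≤ ∑ m ∈ Finset.range T, η m := by
          rw [Finset.mul_sum]
          exact Finset.sum_le_sum fun m _ => (hab m).1
  · calc ∑ m ∈ Finset.range T, η m ^ 2
        ≤ ∑ m ∈ Finset.range T, (b * (1 / √((m : ℝ) + 1))) ^ 2 :=
          Finset.sum_le_sum fun m _ => pow_le_pow_left₀ (hpos m).le (hab m).2 2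
      _ = b ^ 2 * ∑ m ∈ Finset.range T, (1 / √((m : ℝ) + 1)) ^ 2 := by
          simp only [mul_pow, Finset.mul_sum]
      _ ≤ b ^ 2 * ((1 / Real.log 2 + 1) * Real.log T) := by
          gcongr
          exact sum_sq_one_div_sqrt_le hT
      _ = 5 / 8 * (8 / 5 * (b ^ 2 * (1 / Real.log 2 + 1)) * Real.log T) := by ring

end StepSizes

section Integration

variable {α β : Type*} [MeasurableSpace α] [MeasurableSpace β] {μ : Measure α}

theorem integrable_of_abs_le [Countable α] [MeasurableSingletonClass α] [IsFiniteMeasure μ]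
    {f : α → ℝ} {B : ℝ} (hf : ∀ x, |f x| ≤ B) : Integrable f μ :=
  .of_bound (measurable_of_countable f).aestronglyMeasurable B (ae_of_all _ hf)

theorem abs_integral_le_of_abs_le [IsProbabilityMeasure μ] {f : α → ℝ} {B : ℝ}
    (hf : ∀ x, |f x| ≤ B) : |∫ x, f x ∂μ| ≤ B := by
  simpa using norm_integral_le_of_norm_le_const (μ := μ) (f := f) (ae_of_all _ hf)

theorem integral_bind_kernel {κ : Kernel α β} {f : β → ℝ} (hf : Integrable f (μ.bind κ)) :
    ∫ y, f y ∂(μ.bind κ) = ∫ x, ∫ y, f y ∂κ x ∂μ := by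
  rw [Measure.comp_eq_comp_const_apply] at hf ⊢
  rw [Kernel.integral_comp hf, Kernel.const_apply]

theorem integral_ofReal_smul_add_ofReal_smul {ν : Measure α} {f : α → ℝ} (hμ : Integrable f μ)
    (hν : Integrable f ν) {a b : ℝ} (ha : 0 ≤ a) (hb : 0 ≤ b) :
    ∫ x, f x ∂(ENNReal.ofReal a • μ + ENNReal.ofReal b • ν) =
      a * ∫ x, f x ∂μ + b * ∫ x, f x ∂ν := by
  rw [integral_add_measure (hμ.smul_measure ENNReal.ofReal_ne_top)
    (hν.smul_measure ENNReal.ofReal_ne_top), integral_smul_measure, integral_smul_measure,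
    ENNReal.toReal_ofReal ha, ENNReal.toReal_ofReal hb, smul_eq_mul, smul_eq_mul]

theorem integral_tsum_pow_mul [IsFiniteMeasure μ] {γ : ℝ} (h0 : 0 ≤ γ) (h1 : γ < 1)
    {g : ℕ → α → ℝ} (hgm : ∀ t, AEStronglyMeasurable (g t) μ) {B : ℝ} (hg : ∀ t x, |g t x| ≤ B) :
    ∫ x, ∑' t, γ ^ t * g t x ∂μ = ∑' t, γ ^ t * ∫ x, g t x ∂μ := by
  have hbound : ∀ t x, ‖γ ^ t * g t x‖ ≤ γ ^ t * B := fun t x => by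
    rw [norm_mul, Real.norm_of_nonneg (pow_nonneg h0 t)]
    exact mul_le_mul_of_nonneg_left (hg t x) (pow_nonneg h0 t)
  have hsum : Summable fun t : ℕ => γ ^ t * B := (summable_geometric_of_lt_one h0 h1).mul_right B
  have hasSum := hasSum_integral_of_dominated_convergence (fun t _ => γ ^ t * B)
    (fun t => (hgm t).const_mul _) (fun t => ae_of_all μ (hbound t)) (ae_of_all _ fun _ => hsum)
    (integrable_const _) (ae_of_all _ fun x => (hsum.of_norm_bounded (hbound · x)).hasSum)
  simpa only [integral_const_mul] using hasSum.tsum_eq.symm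

theorem compProd_singleton [MeasurableSingletonClass α] [MeasurableSingletonClass β] [SFinite μ]
    (κ : Kernel α β) [IsSFiniteKernel κ] (x : α × β) : (μ ⊗ₘ κ) {x} = κ x.1 {x.2} * μ {x.1} := by
  rw [← Prod.mk.eta (p := x), ← Set.singleton_prod_singleton, Measure.compProd_apply_prod
    (measurableSet_singleton _) (measurableSet_singleton _), lintegral_singleton]

theorem measurable_of_measurable_apply_singleton [Countable α] [MeasurableSingletonClass α]
    {f : β → Measure α} (hf : ∀ x, Measurable fun b => f b {x}) : Measurable f := by
  refine Measure.measurable_of_measurable_coe _ fun s _ => ?_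
  have hsum : ∀ b, f b s = ∑' x : s, f b {(x : α)} := fun b => by
    rw [← measure_biUnion s.to_countable (fun x _ y _ hxy => by simpa using hxy)
      (fun x _ => measurableSet_singleton x), Set.biUnion_of_singleton]
  simp_rw [hsum]
  exact Measurable.tsum fun x => hf x

instance measurableSingletonClass_probabilityMeasure [Countable α] [MeasurableSingletonClass α] :
    MeasurableSingletonClass (ProbabilityMeasure α) := by
  refine ⟨fun ν => ?_⟩
  have hiInter : ({ν} : Set (ProbabilityMeasure α)) =
      ⋂ a : α, (fun ν' : ProbabilityMeasure α => (ν' : Measure α) {a}) ⁻¹'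
        {(ν : Measure α) {a}} := by
    ext ν'
    simp only [Set.mem_singleton_iff, Set.mem_iInter, Set.mem_preimage]
    exact ⟨fun h a => by rw [h], fun h => Subtype.ext (Measure.ext_of_singleton h)⟩
  rw [hiInter]
  exact .iInter fun a => ((Measure.measurable_coe (measurableSet_singleton a)).comp
    measurable_subtype_coe) (measurableSet_singleton _)

end Integration

namespace CMDP

noncomputable section

attribute [instance] CMDP.markov

section Weights

variable {S A : Type*} [MeasurableSpace S] [MeasurableSpace A] {K : ℕ} (X : CMDP S A K)

theorem one_sub_γ_pos : 0 < 1 - X.γ := sub_pos.2 X.γ_lt_one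

theorem hasSum_weights : HasSum (fun t : ℕ => (1 - X.γ) * X.γ ^ t) 1 := by
  simpa only [mul_inv_cancel₀ X.one_sub_γ_pos.ne'] using
    (hasSum_geometric_of_lt_one X.γ_pos.le X.γ_lt_one).mul_left (1 - X.γ)

theorem weight_nonneg (t : ℕ) : 0 ≤ (1 - X.γ) * X.γ ^ t :=
  mul_nonneg X.one_sub_γ_pos.le (pow_nonneg X.γ_pos.le t)

end Weights

section Trajectory

variable {S A : Type*} [Countable S] [MeasurableSpace S] [MeasurableSingletonClass S]
  [MeasurableSpace A] {K : ℕ} (X : CMDP S A K) (π : StationaryPolicy S A)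

instance : IsMarkovKernel (policyKernel π) :=
  ⟨fun s => inferInstanceAs (IsProbabilityMeasure (π s : Measure A))⟩

instance : IsProbabilityMeasure (X.initLaw π) := by
  unfold initLaw
  infer_instance

/-- The law of `(s₁, a₁)` under `π` when `(s₀, a₀)` has law `ν`, so that `law` is its iteration. -/
def stepLaw (ν : Measure (S × A)) : Measure (S × A) :=
  (ν.bind X.P) ⊗ₘ policyKernel π

theorem law_succ (ν : Measure (S × A)) (t : ℕ) :
    X.law π ν (t + 1) = X.stepLaw π (X.law π ν t) := rfl

theorem law_succ' (ν : Measure (S × A)) (t : ℕ) :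
    X.law π ν (t + 1) = X.law π (X.stepLaw π ν) t := by
  induction t with
  | zero => rfl
  | succ t ih => rw [law_succ, ih, law_succ]

/-- The value `(1 - γ) E[∑ₜ γ^t f(s_t, a_t) | s₀ = s, a₀ = a]` of a state-action pair under `π` for
an arbitrary instantaneous cost `f`; the `Q`-function is the case `f = c^l`. -/
def actionValue (f : S → A → ℝ) (s : S) (a : A) : ℝ :=
  X.discounted f π (Measure.dirac (s, a))

/-- The value of a state under `π`: the average of `actionValue` over the actions chosen by `π`. -/
def stateValue (f : S → A → ℝ) (s : S) : ℝ :=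
  ∫ a, X.actionValue π f s a ∂(π s : Measure A)

variable {f : S → A → ℝ} {B : ℝ} (ν : Measure (S × A)) [IsProbabilityMeasure ν]

instance : IsProbabilityMeasure (X.stepLaw π ν) := by
  unfold stepLaw
  infer_instance

instance (t : ℕ) : IsProbabilityMeasure (X.law π ν t) := by
  induction t with
  | zero => assumption
  | succ t ih => exact inferInstanceAs (IsProbabilityMeasure (X.stepLaw π _))

instance : IsProbabilityMeasure (X.occ π) := by
  constructor
  rw [occ, Measure.sum_apply _ MeasurableSet.univ]
  simp only [Measure.smul_apply, measure_univ, smul_eq_mul, mul_one]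
  rw [← ENNReal.ofReal_tsum_of_nonneg X.weight_nonneg X.hasSum_weights.summable,
    X.hasSum_weights.tsum_eq, ENNReal.ofReal_one]

theorem summable_discounted (hf : ∀ s a, |f s a| ≤ B) :
    Summable fun t : ℕ => X.γ ^ t * ∫ x, f x.1 x.2 ∂(X.law π ν t) := by
  refine .of_norm_bounded
    ((summable_geometric_of_lt_one X.γ_pos.le X.γ_lt_one).mul_right B) fun t => ?_
  rw [norm_mul, Real.norm_of_nonneg (pow_nonneg X.γ_pos.le t)]
  exact mul_le_mul_of_nonneg_left (abs_integral_le_of_abs_le fun x => hf x.1 x.2)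
    (pow_nonneg X.γ_pos.le t)

theorem discounted_eq_add_discounted_stepLaw (hf : ∀ s a, |f s a| ≤ B) :
    X.discounted f π ν =
      (1 - X.γ) * ∫ x, f x.1 x.2 ∂ν + X.γ * X.discounted f π (X.stepLaw π ν) := by
  rw [discounted, (X.summable_discounted π ν hf).tsum_eq_zero_add, discounted]
  simp_rw [law_succ', pow_succ', mul_assoc, tsum_mul_left]
  simp only [law, pow_zero, one_mul]
  ring

theorem abs_discounted_le (hf : ∀ s a, |f s a| ≤ B) : |X.discounted f π ν| ≤ B := by
  rw [discounted, ← tsum_mul_left, ← one_mul B, ← Real.norm_eq_abs]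
  refine tsum_of_norm_bounded (X.hasSum_weights.mul_right B) fun t => ?_
  rw [← mul_assoc, norm_mul, Real.norm_of_nonneg (X.weight_nonneg t)]
  exact mul_le_mul_of_nonneg_left (abs_integral_le_of_abs_le fun x => hf x.1 x.2)
    (X.weight_nonneg t)

theorem abs_actionValue_le (hf : ∀ s a, |f s a| ≤ B) (s : S) (a : A) :
    |X.actionValue π f s a| ≤ B :=
  X.abs_discounted_le π _ hf

theorem abs_stateValue_le (hf : ∀ s a, |f s a| ≤ B) (s : S) : |X.stateValue π f s| ≤ B :=
  abs_integral_le_of_abs_le (X.abs_actionValue_le π hf s)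

end Trajectory

section Bellman

variable {S A : Type*} [Countable S] [MeasurableSpace S] [MeasurableSingletonClass S]
  [Countable A] [MeasurableSpace A] [MeasurableSingletonClass A] {K : ℕ} (X : CMDP S A K)
  (π : StationaryPolicy S A) {f : S → A → ℝ} {B : ℝ}

theorem integral_compProd_policyKernel (μ : Measure S) [IsFiniteMeasure μ]
    (hf : ∀ s a, |f s a| ≤ B) :
    ∫ x, f x.1 x.2 ∂(μ ⊗ₘ policyKernel π) = ∫ s, ∫ a, f s a ∂(π s : Measure A) ∂μ :=
  Measure.integral_compProd (integrable_of_abs_le fun x => hf x.1 x.2)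

theorem integral_stepLaw (ν : Measure (S × A)) [IsProbabilityMeasure ν]
    (hf : ∀ s a, |f s a| ≤ B) :
    ∫ x, f x.1 x.2 ∂(X.stepLaw π ν) = ∫ x, ∫ s, ∫ a, f s a ∂(π s : Measure A) ∂(X.P x) ∂ν := by
  rw [stepLaw, integral_compProd_policyKernel π _ hf, integral_bind_kernel]
  exact integrable_of_abs_le fun s => abs_integral_le_of_abs_le (hf s)

theorem integral_law_eq_integral_dirac (hf : ∀ s a, |f s a| ≤ B) (t : ℕ) (ν : Measure (S × A))
    [IsProbabilityMeasure ν] :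
    ∫ x, f x.1 x.2 ∂(X.law π ν t) = ∫ y, ∫ x, f x.1 x.2 ∂(X.law π (Measure.dirac y) t) ∂ν := by
  induction t generalizing ν with
  | zero => simp only [law, integral_dirac]
  | succ t ih =>
    have hbound : ∀ s a, |∫ x, f x.1 x.2 ∂(X.law π (Measure.dirac (s, a)) t)| ≤ B := fun s a =>
      abs_integral_le_of_abs_le fun x => hf x.1 x.2
    simp_rw [law_succ', ih (X.stepLaw π _)]
    simp_rw [X.integral_stepLaw π _ hbound, integral_dirac]

theorem discounted_eq_integral_actionValue (ν : Measure (S × A)) [IsProbabilityMeasure ν]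
    (hf : ∀ s a, |f s a| ≤ B) :
    X.discounted f π ν = ∫ x, X.actionValue π f x.1 x.2 ∂ν := by
  have hswap := integral_tsum_pow_mul (μ := ν) X.γ_pos.le X.γ_lt_one
    (g := fun t y => ∫ x, f x.1 x.2 ∂(X.law π (Measure.dirac y) t))
    (fun t => (measurable_of_countable _).aestronglyMeasurable)
    fun t y => abs_integral_le_of_abs_le fun x => hf x.1 x.2
  simp_rw [← X.integral_law_eq_integral_dirac π hf] at hswap
  simp_rw [actionValue, discounted, integral_const_mul, Prod.mk.eta, hswap]

theorem discounted_initLaw (hf : ∀ s a, |f s a| ≤ B) :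
    X.discounted f π (X.initLaw π) = ∫ s, X.stateValue π f s ∂(X.μ₀ : Measure S) := by
  rw [X.discounted_eq_integral_actionValue π _ hf, initLaw,
    integral_compProd_policyKernel π _ (X.abs_actionValue_le π hf)]
  rfl

theorem actionValue_eq_add_integral_stateValue (hf : ∀ s a, |f s a| ≤ B) (s : S) (a : A) :
    X.actionValue π f s a =
      (1 - X.γ) * f s a + X.γ * ∫ s', X.stateValue π f s' ∂(X.P (s, a)) := by
  rw [actionValue, X.discounted_eq_add_discounted_stepLaw π _ hf, integral_dirac,
    X.discounted_eq_integral_actionValue π _ hf,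
    X.integral_stepLaw π _ (X.abs_actionValue_le π hf), integral_dirac]
  rfl

end Bellman

section Occupation

variable {S A : Type*} [Countable S] [MeasurableSpace S] [MeasurableSingletonClass S]
  [Countable A] [MeasurableSpace A] [MeasurableSingletonClass A] {K : ℕ} (X : CMDP S A K)

section Flow

variable (π : StationaryPolicy S A)

theorem integral_occ {f : S → A → ℝ} {B : ℝ} (hf : ∀ s a, |f s a| ≤ B) :
    ∫ x, f x.1 x.2 ∂(X.occ π) = X.discounted f π (X.initLaw π) := by
  have hint : Integrable (fun x : S × A => f x.1 x.2) (X.occ π) :=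
    integrable_of_abs_le fun x => hf x.1 x.2
  rw [occ] at hint ⊢
  rw [integral_sum_measure hint, discounted, ← tsum_mul_left]
  refine tsum_congr fun t => ?_
  rw [integral_smul_measure, ENNReal.toReal_ofReal (X.weight_nonneg t), smul_eq_mul, mul_assoc]

theorem integral_fst_stepLaw (ν : Measure (S × A)) [IsProbabilityMeasure ν] {h : S → ℝ} {B : ℝ}
    (hh : ∀ s, |h s| ≤ B) :
    ∫ x, h x.1 ∂(X.stepLaw π ν) = ∫ x, ∫ s, h s ∂(X.P x) ∂ν := by
  simpa using X.integral_stepLaw π ν (f := fun s _ => h s) fun s _ => hh s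

theorem integral_fst_initLaw {h : S → ℝ} {B : ℝ} (hh : ∀ s, |h s| ≤ B) :
    ∫ x, h x.1 ∂(X.initLaw π) = ∫ s, h s ∂(X.μ₀ : Measure S) := by
  simpa [initLaw] using integral_compProd_policyKernel π (X.μ₀ : Measure S) (f := fun s _ => h s)
    fun s _ => hh s

theorem integral_fst_occ {h : S → ℝ} {B : ℝ} (hh : ∀ s, |h s| ≤ B) :
    ∫ x, h x.1 ∂(X.occ π) = (1 - X.γ) * ∫ s, h s ∂(X.μ₀ : Measure S) +
      X.γ * ∫ x, ∫ s, h s ∂(X.P x) ∂(X.occ π) := by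
  have hPh : ∀ s a, |∫ s', h s' ∂(X.P (s, a))| ≤ B := fun s a => abs_integral_le_of_abs_le hh
  have hsucc : ∀ t, ∫ x, h x.1 ∂(X.law π (X.initLaw π) (t + 1)) =
      ∫ x, ∫ s, h s ∂(X.P x) ∂(X.law π (X.initLaw π) t) := fun t =>
    X.integral_fst_stepLaw π _ hh
  have hocc := X.integral_occ π (f := fun s _ => h s) fun s _ => hh s
  have hoccP := X.integral_occ π hPh
  simp only [Prod.mk.eta] at hoccP
  rw [hocc, hoccP, discounted, (X.summable_discounted π _ fun s _ => hh s).tsum_eq_zero_add,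
    discounted]
  simp_rw [hsucc, pow_succ', mul_assoc, tsum_mul_left, Prod.mk.eta]
  rw [law, X.integral_fst_initLaw π hh]
  ring

end Flow

section Mixing

theorem measurable_compProd_policyKernel {μ : StationaryPolicy S A → Measure S}
    [∀ π, SFinite (μ π)] (hμ : Measurable μ) : Measurable fun π => μ π ⊗ₘ policyKernel π := by
  refine measurable_of_measurable_apply_singleton fun x => ?_
  simp_rw [compProd_singleton]
  have hpolicy : Measurable fun π : StationaryPolicy S A => (π x.1 : Measure A) {x.2} :=
    (Measure.measurable_coe (measurableSet_singleton _)).comp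
      (measurable_subtype_coe.comp (measurable_pi_apply x.1))
  exact hpolicy.mul ((Measure.measurable_coe (measurableSet_singleton _)).comp hμ)

theorem measurable_law_initLaw (t : ℕ) :
    Measurable fun π : StationaryPolicy S A => X.law π (X.initLaw π) t := by
  induction t with
  | zero => exact measurable_compProd_policyKernel measurable_const
  | succ t ih =>
    exact measurable_compProd_policyKernel ((Measure.measurable_bind' X.P.measurable).comp ih)

theorem measurable_occ : Measurable X.occ := by
  refine measurable_of_measurable_apply_singleton fun x => ?_
  simp only [occ, Measure.sum_apply _ (measurableSet_singleton x), Measure.smul_apply, smul_eq_mul]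
  exact Measurable.tsum fun t => ((Measure.measurable_coe
    (measurableSet_singleton x)).comp (X.measurable_law_initLaw t)).const_mul _

/-- The occupation measures of stationary policies as a Markov kernel, so that `occMix` is the
composition of a mixing policy with it. -/
def occKernel : Kernel (StationaryPolicy S A) (S × A) := ⟨X.occ, X.measurable_occ⟩

instance : IsMarkovKernel X.occKernel :=
  ⟨fun π => inferInstanceAs (IsProbabilityMeasure (X.occ π))⟩

variable (ρ : Measure (StationaryPolicy S A)) [IsProbabilityMeasure ρ]

instance : IsProbabilityMeasure (X.occMix ρ) :=
  inferInstanceAs (IsProbabilityMeasure (ρ.bind X.occKernel))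

theorem integral_occMix {f : S × A → ℝ} {B : ℝ} (hf : ∀ x, |f x| ≤ B) :
    ∫ x, f x ∂(X.occMix ρ) = ∫ π, ∫ x, f x ∂(X.occ π) ∂ρ :=
  integral_bind_kernel (κ := X.occKernel) (integrable_of_abs_le hf)

theorem integrable_integral_occ {f : S × A → ℝ} {B : ℝ} (hf : ∀ x, |f x| ≤ B) :
    Integrable (fun π => ∫ x, f x ∂(X.occ π)) ρ :=
  .of_bound (StronglyMeasurable.integral_kernel (κ := X.occKernel)
    (measurable_of_countable f).stronglyMeasurable).aestronglyMeasurable B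
    (ae_of_all _ fun _ => abs_integral_le_of_abs_le hf)

theorem integrable_discounted {f : S → A → ℝ} {B : ℝ} (hf : ∀ s a, |f s a| ≤ B) :
    Integrable (fun π => X.discounted f π (X.initLaw π)) ρ := by
  simp_rw [← X.integral_occ _ hf]
  exact X.integrable_integral_occ ρ fun x => hf x.1 x.2

theorem integral_discounted {f : S → A → ℝ} {B : ℝ} (hf : ∀ s a, |f s a| ≤ B) :
    ∫ π, X.discounted f π (X.initLaw π) ∂ρ = ∫ x, f x.1 x.2 ∂(X.occMix ρ) := by
  simp_rw [← X.integral_occ _ hf]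
  exact (X.integral_occMix ρ fun x => hf x.1 x.2).symm

theorem integral_fst_occMix {h : S → ℝ} {B : ℝ} (hh : ∀ s, |h s| ≤ B) :
    ∫ s, h s ∂(X.occMix ρ).fst = (1 - X.γ) * ∫ s, h s ∂(X.μ₀ : Measure S) +
      X.γ * ∫ x, ∫ s, h s ∂(X.P x) ∂(X.occMix ρ) := by
  have hPh : ∀ x, |∫ s', h s' ∂(X.P x)| ≤ B := fun x => abs_integral_le_of_abs_le hh
  rw [Measure.fst, integral_map measurable_fst.aemeasurable
    (measurable_of_countable h).aestronglyMeasurable, X.integral_occMix ρ fun x => hh x.1,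
    X.integral_occMix ρ hPh]
  simp_rw [X.integral_fst_occ _ hh]
  rw [integral_add (integrable_const _) ((X.integrable_integral_occ ρ hPh).const_mul _),
    integral_const, probReal_univ, one_smul, integral_const_mul]

end Mixing

end Occupation

section InducedPolicy

variable {S A : Type*} [Countable S] [MeasurableSpace S] [MeasurableSingletonClass S]
  [MeasurableSpace A]

theorem ae_isProbabilityMeasure_inducedPolicy (ν : Measure (S × A)) [IsFiniteMeasure ν] :
    ∀ᵐ s ∂ν.fst, IsProbabilityMeasure (inducedPolicy ν s) := by
  refine ae_iff_of_countable.2 fun s hs => ?_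
  rw [Measure.fst_apply (measurableSet_singleton s)] at hs
  have := cond_isProbabilityMeasure hs
  exact Measure.isProbabilityMeasure_map measurable_snd.aemeasurable

/-- `inducedPolicy ν` as a kernel: the conditional law of the action given the state under `ν`.
It need not be Markov, since it vanishes at the states that `ν` does not charge. -/
def inducedKernel (ν : Measure (S × A)) : Kernel S A :=
  Kernel.ofFunOfCountable (inducedPolicy ν)

instance (ν : Measure (S × A)) : IsFiniteKernel (inducedKernel ν) := by
  refine ⟨1, ENNReal.one_lt_top, fun s => ?_⟩
  have hmap : inducedKernel ν s Set.univ = cond ν (Prod.fst ⁻¹' {s}) Set.univ :=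
    (Measure.map_apply measurable_snd .univ).trans (by rw [Set.preimage_univ])
  exact hmap.trans_le prob_le_one

variable [Countable A] [MeasurableSingletonClass A]

theorem fst_compProd_inducedKernel (ν : Measure (S × A)) [IsFiniteMeasure ν] :
    ν.fst ⊗ₘ inducedKernel ν = ν := by
  refine Measure.ext_of_singleton fun x => ?_
  have hfst : MeasurableSet (Prod.fst ⁻¹' {x.1} : Set (S × A)) :=
    measurable_fst (measurableSet_singleton _)
  have hinter : (Prod.fst ⁻¹' {x.1} ∩ Prod.snd ⁻¹' {x.2} : Set (S × A)) = {x} := by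
    ext y
    simp [Prod.ext_iff]
  have hcond : inducedKernel ν x.1 {x.2} = (ν (Prod.fst ⁻¹' {x.1}))⁻¹ * ν {x} := by
    change (cond ν (Prod.fst ⁻¹' {x.1})).map Prod.snd {x.2} = _
    rw [Measure.map_apply measurable_snd (measurableSet_singleton _), cond_apply hfst, hinter]
  rw [compProd_singleton, hcond, Measure.fst_apply (measurableSet_singleton _), mul_right_comm]
  rcases eq_or_ne (ν (Prod.fst ⁻¹' {x.1})) 0 with hnull | hcharged
  · rw [hnull, mul_zero, zero_mul]
    exact (measure_mono_null (by simp) hnull).symm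
  · rw [ENNReal.inv_mul_cancel hcharged (measure_ne_top _ _), one_mul]

variable (ν : Measure (S × A)) [IsFiniteMeasure ν] {f : S → A → ℝ} {B : ℝ}

theorem integral_inducedPolicy (hf : ∀ s a, |f s a| ≤ B) :
    ∫ s, ∫ a, f s a ∂(inducedPolicy ν s) ∂ν.fst = ∫ x, f x.1 x.2 ∂ν := by
  have hint : Integrable (fun x : S × A => f x.1 x.2) (ν.fst ⊗ₘ inducedKernel ν) :=
    integrable_of_abs_le fun x => hf x.1 x.2
  conv_rhs => rw [← fst_compProd_inducedKernel ν]
  exact (Measure.integral_compProd hint).symm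

theorem integrable_integral_inducedPolicy (hf : ∀ s a, |f s a| ≤ B) :
    Integrable (fun s => ∫ a, f s a ∂(inducedPolicy ν s)) ν.fst := by
  have hint : Integrable (fun x : S × A => f x.1 x.2) (ν.fst ⊗ₘ inducedKernel ν) :=
    integrable_of_abs_le fun x => hf x.1 x.2
  exact hint.integral_compProd (κ := Kernel.const Unit ν.fst)
    (η := (inducedKernel ν).prodMkLeft Unit) (a := ())

end InducedPolicy

section PolicyRegret

variable {S A : Type*} [Countable S] [MeasurableSpace S] [MeasurableSingletonClass S]
  [MeasurableSpace A] {K : ℕ} (X : CMDP S A K) (ρ : Measure (StationaryPolicy S A))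

/-- The expected saving at state `s` from choosing one action by the stationary policy equivalent
to the mixing policy `ρ` instead of by `π`, for the instantaneous cost `f`. -/
def advantage (π : StationaryPolicy S A) (f : S → A → ℝ) (s : S) : ℝ :=
  X.stateValue π f s - ∫ a, X.actionValue π f s a ∂(inducedPolicy (X.occMix ρ) s)

variable [Countable A] [MeasurableSingletonClass A] [IsProbabilityMeasure ρ]

section PerformanceDifference

variable (π : StationaryPolicy S A) {f : S → A → ℝ} {B : ℝ}

theorem integrable_advantage (hf : ∀ s a, |f s a| ≤ B) :
    Integrable (X.advantage ρ π f) (X.occMix ρ).fst :=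
  (integrable_of_abs_le (X.abs_stateValue_le π hf)).sub
    (integrable_integral_inducedPolicy _ (X.abs_actionValue_le π hf))

/-- The performance difference lemma: insert the Bellman equation for the action value and cancel
the state values by the flow equation of the occupation measure. -/
theorem integral_advantage (hf : ∀ s a, |f s a| ≤ B) :
    ∫ s, X.advantage ρ π f s ∂(X.occMix ρ).fst =
      (1 - X.γ) * (X.discounted f π (X.initLaw π) - ∫ x, f x.1 x.2 ∂(X.occMix ρ)) := by
  have hf_int : Integrable (fun x : S × A => f x.1 x.2) (X.occMix ρ) :=
    integrable_of_abs_le fun x => hf x.1 x.2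
  have hnext_int : Integrable (fun x => ∫ s, X.stateValue π f s ∂(X.P x)) (X.occMix ρ) :=
    integrable_of_abs_le fun x => abs_integral_le_of_abs_le (X.abs_stateValue_le π hf)
  have hbellman : ∫ x, X.actionValue π f x.1 x.2 ∂(X.occMix ρ) =
      (1 - X.γ) * ∫ x, f x.1 x.2 ∂(X.occMix ρ) +
        X.γ * ∫ x, ∫ s, X.stateValue π f s ∂(X.P x) ∂(X.occMix ρ) := by
    simp_rw [X.actionValue_eq_add_integral_stateValue π hf, Prod.mk.eta]
    rw [integral_add (hf_int.const_mul _) (hnext_int.const_mul _), integral_const_mul,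
      integral_const_mul]
  simp only [advantage]
  rw [integral_sub (integrable_of_abs_le (X.abs_stateValue_le π hf))
      (integrable_integral_inducedPolicy _ (X.abs_actionValue_le π hf)),
    integral_inducedPolicy _ (X.abs_actionValue_le π hf), hbellman,
    X.integral_fst_occMix ρ (X.abs_stateValue_le π hf), X.discounted_initLaw π hf]
  ring

end PerformanceDifference

variable {π : ℕ → StationaryPolicy S A} {f : ℕ → S → A → ℝ} {η : ℕ → ℝ} {G : ℝ}

theorem ae_sum_mul_advantage_le (hG : ∀ m s a, |X.actionValue (π m) (f m) s a| ≤ G)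
    (hstep : ∀ m s, (π (m + 1) s : Measure A) =
      (π m s : Measure A).tilted fun a => -(η m * X.actionValue (π m) (f m) s a))
    (hΦ : X.potential ρ (π 0) ≠ ∞) (T : ℕ) :
    ∀ᵐ s ∂(X.occMix ρ).fst, ∑ m ∈ Finset.range T, η m * X.advantage ρ (π m) (f m) s ≤
      (InformationTheory.klDiv (inducedPolicy (X.occMix ρ) s) (π 0 s : Measure A)).toReal +
        G ^ 2 / 2 * ∑ m ∈ Finset.range T, η m ^ 2 := by
  filter_upwards [ae_lt_top' (measurable_of_countable _).aemeasurable hΦ,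
    ae_isProbabilityMeasure_inducedPolicy (X.occMix ρ)] with s hs _
  exact sum_mul_integral_sub_integral_le_of_tilted (ν := fun m => (π m s : Measure A))
    (fun m => measurable_of_countable _) (fun m a => hG m s a) (hstep · s) hs.ne T

theorem sum_mul_discounted_sub_integral_occMix_le (hf : ∀ m, ∃ B : ℝ, ∀ s a, |f m s a| ≤ B)
    (hG : ∀ m s a, |X.actionValue (π m) (f m) s a| ≤ G)
    (hstep : ∀ m s, (π (m + 1) s : Measure A) =
      (π m s : Measure A).tilted fun a => -(η m * X.actionValue (π m) (f m) s a))
    (hΦ : X.potential ρ (π 0) ≠ ∞) (T : ℕ) :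
    (1 - X.γ) * ∑ m ∈ Finset.range T, η m *
        (X.discounted (f m) (π m) (X.initLaw (π m)) - ∫ x, f m x.1 x.2 ∂(X.occMix ρ)) ≤
      (X.potential ρ (π 0)).toReal + G ^ 2 / 2 * ∑ m ∈ Finset.range T, η m ^ 2 := by
  choose B hB using hf
  have hadv_int : ∀ m, Integrable (fun s => η m * X.advantage ρ (π m) (f m) s)
      (X.occMix ρ).fst := fun m => (X.integrable_advantage ρ (π m) (hB m)).const_mul _
  have hkl_meas : AEMeasurable (fun s => InformationTheory.klDiv (inducedPolicy (X.occMix ρ) s)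
      (π 0 s : Measure A)) (X.occMix ρ).fst := (measurable_of_countable _).aemeasurable
  have hkl_int := integrable_toReal_of_lintegral_ne_top hkl_meas hΦ
  have hle := integral_mono_ae (integrable_finsetSum (Finset.range T) fun m _ => hadv_int m)
    (hkl_int.add (integrable_const _)) (X.ae_sum_mul_advantage_le ρ hG hstep hΦ T)
  simp only [Pi.add_apply] at hle
  rw [integral_finsetSum _ fun m _ => hadv_int m, integral_add hkl_int (integrable_const _),
    integral_toReal hkl_meas (ae_lt_top' hkl_meas hΦ), integral_const, probReal_univ,
    one_smul] at hle
  simp_rw [integral_const_mul, X.integral_advantage ρ _ (hB _), mul_left_comm (η _),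
    ← Finset.mul_sum] at hle
  exact hle

end PolicyRegret

section Costs

variable {S A : Type*} [MeasurableSpace S] [MeasurableSpace A] {K : ℕ}

/-- Each instantaneous cost is bounded. This holds in every `Setting`, and it makes all integrals
in the definitions of `cost`, `auxCost` and `qFun` converge. -/
structure BoundedCosts (X : CMDP S A K) : Prop where
  exists_abs_c_le : ∃ B : ℝ, ∀ s a, |X.c s a| ≤ B
  exists_abs_d_le : ∀ k, ∃ B : ℝ, ∀ s a, |X.d k s a| ≤ B

theorem BoundedCosts.exists_abs_modCost_le {X : CMDP S A K} (h : X.BoundedCosts)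
    (y : EuclideanSpace ℝ (Fin K)) : ∃ B : ℝ, ∀ s a, |X.modCost y s a| ≤ B := by
  obtain ⟨Bc, hBc⟩ := h.exists_abs_c_le
  choose Bd hBd using h.exists_abs_d_le
  refine ⟨Bc + ∑ k, |y k| * (Bd k + |X.q k|), fun s a => ?_⟩
  refine (abs_add_le _ _).trans (add_le_add (hBc s a) ?_)
  refine (Finset.abs_sum_le_sum_abs _ _).trans (Finset.sum_le_sum fun k _ => ?_)
  rw [abs_mul]
  exact mul_le_mul_of_nonneg_left
    ((abs_sub _ _).trans (add_le_add_left (hBd k s a) _)) (abs_nonneg _)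

theorem modCost_zero (X : CMDP S A K) : X.modCost 0 = X.c := by
  ext s a
  simp [modCost]

theorem modCost_single (X : CMDP S A K) (k : Fin K) (t : ℝ) (s : S) (a : A) :
    X.modCost (EuclideanSpace.single k t) s a = X.c s a + t * (X.d k s a - X.q k) := by
  simp [modCost]

variable [Countable S] [MeasurableSingletonClass S] {X : CMDP S A K}

theorem FiniteDiscounted.summable {f : S → A → ℝ} {π : StationaryPolicy S A}
    {ν : Measure (S × A)} (h : X.FiniteDiscounted f π ν) :
    Summable fun t : ℕ => X.γ ^ t * ∫ x, f x.1 x.2 ∂(X.law π ν t) := by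
  refine .of_norm_bounded h.2 fun t => ?_
  rw [norm_mul, Real.norm_of_nonneg (pow_nonneg X.γ_pos.le t)]
  exact mul_le_mul_of_nonneg_left (norm_integral_le_integral_norm _) (pow_nonneg X.γ_pos.le t)

theorem FiniteDiscounted.mul_integral_add_mul_le_discounted {f : S → A → ℝ}
    {π : StationaryPolicy S A} {ν : Measure (S × A)} [IsProbabilityMeasure ν]
    (h : X.FiniteDiscounted f π ν) {W : ℝ} (hW : ∀ s a, W ≤ f s a) :
    (1 - X.γ) * ∫ x, f x.1 x.2 ∂ν + X.γ * W ≤ X.discounted f π ν := by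
  have hgeom := (hasSum_geometric_of_lt_one X.γ_pos.le X.γ_lt_one).mul_right (X.γ * W)
  have htail : (1 - X.γ)⁻¹ * (X.γ * W) ≤
      ∑' t : ℕ, X.γ ^ (t + 1) * ∫ x, f x.1 x.2 ∂(X.law π ν (t + 1)) := by
    rw [← hgeom.tsum_eq]
    refine hgeom.summable.tsum_le_tsum (fun t => ?_) ((summable_nat_add_iff 1).2 h.summable)
    have hWt : W ≤ ∫ x, f x.1 x.2 ∂(X.law π ν (t + 1)) := by
      simpa using integral_mono (integrable_const W) (h.1 (t + 1)) fun x => hW x.1 x.2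
    rw [pow_succ, mul_assoc]
    exact mul_le_mul_of_nonneg_left (mul_le_mul_of_nonneg_left hWt X.γ_pos.le)
      (pow_nonneg X.γ_pos.le t)
  have hscaled := mul_le_mul_of_nonneg_left htail X.one_sub_γ_pos.le
  rw [mul_inv_cancel_left₀ X.one_sub_γ_pos.ne'] at hscaled
  rw [discounted, h.summable.tsum_eq_zero_add, mul_add, pow_zero, one_mul]
  exact add_le_add_right hscaled _

variable [Countable A] [MeasurableSingletonClass A]

theorem BoundedSubgradient.abs_qFun_le {Λ : Set (EuclideanSpace ℝ (Fin K))} {G : ℝ}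
    (h : X.BoundedSubgradient Λ G) {y : EuclideanSpace ℝ (Fin K)} (hy : y ∈ Λ)
    (π : StationaryPolicy S A) (s : S) (a : A) : |X.qFun π y s a| ≤ G := by
  simpa only [qFunMix, integral_dirac] using
    ((h y hy).2 (Measure.dirac π) inferInstance).2 s a

theorem BoundedSubgradient.exists_modCost_le {Λ : Set (EuclideanSpace ℝ (Fin K))} {G : ℝ}
    (h : X.BoundedSubgradient Λ G) {y : EuclideanSpace ℝ (Fin K)} (hy : y ∈ Λ)
    (π : StationaryPolicy S A) {W : ℝ} (hW : ∀ s a, W ≤ X.modCost y s a) :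
    ∃ U : ℝ, ∀ s a, X.modCost y s a ≤ U := by
  refine ⟨(G - X.γ * W) / (1 - X.γ), fun s a => ?_⟩
  have hle := ((h y hy).1 π s a).mul_integral_add_mul_le_discounted hW
  rw [integral_dirac] at hle
  rw [le_div_iff₀' X.one_sub_γ_pos, le_sub_iff_add_le]
  exact hle.trans ((le_abs_self _).trans (h.abs_qFun_le hy π s a))

theorem zero_mem_dualDomain {M r : ℝ} (hMr : 0 ≤ M + r) :
    (0 : EuclideanSpace ℝ (Fin K)) ∈ dualDomain K M r :=
  ⟨by simp, by simpa using hMr⟩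

theorem single_mem_dualDomain {M r : ℝ} (hMr : 0 ≤ M + r) (k : Fin K) :
    EuclideanSpace.single k (M + r) ∈ dualDomain K M r := by
  refine ⟨fun j => ?_, by simp [abs_of_nonneg hMr]⟩
  rw [PiLp.single_apply]
  split_ifs
  exacts [hMr, le_rfl]

/-- The multiplier `0` bounds `c`, and then the multiplier `(M + r) e_k` bounds `d k`. -/
theorem BoundedSubgradient.boundedCosts {M r G : ℝ}
    (h : X.BoundedSubgradient (dualDomain K M r) G) (hMr : 0 < M + r)
    (hbelow : X.CostsBoundedBelow) (π : StationaryPolicy S A) : X.BoundedCosts := by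
  obtain ⟨W, hW⟩ := hbelow
  have hWc : ∀ s a, W ≤ X.c s a := fun s a => (hW s a).1.le
  have hWd : ∀ k s a, W ≤ X.d k s a := fun k s a => ((hW s a).2 k).le
  constructor
  · obtain ⟨U, hU⟩ := h.exists_modCost_le (zero_mem_dualDomain hMr.le) π (W := W)
      (by simpa only [modCost_zero] using hWc)
    rw [modCost_zero] at hU
    exact ⟨max |W| |U|, fun s a => abs_le_max_abs_abs (hWc s a) (hU s a)⟩
  · intro k
    obtain ⟨U, hU⟩ := h.exists_modCost_le (single_mem_dualDomain hMr.le k) π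
      (W := W + (M + r) * (W - X.q k)) fun s a => by
        rw [modCost_single]
        gcongr
        exacts [hWc s a, hWd k s a]
    have hd : ∀ s a, X.d k s a ≤ (U - W) / (M + r) + X.q k := fun s a => by
      rw [← sub_le_iff_le_add, le_div_iff₀' hMr]
      linarith [X.modCost_single k (M + r) s a, hU s a, hWc s a]
    exact ⟨max |W| |(U - W) / (M + r) + X.q k|,
      fun s a => abs_le_max_abs_abs (hWd k s a) (hd s a)⟩

end Costs

section Lagrangian

variable {S A : Type*} [Countable S] [MeasurableSpace S] [MeasurableSingletonClass S]
  [MeasurableSpace A] {K : ℕ} {X : CMDP S A K}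

theorem lagrangian_eq_cost_add_inner (ρ : Measure (StationaryPolicy S A))
    (y : EuclideanSpace ℝ (Fin K)) :
    X.lagrangian ρ y = X.cost ρ + inner ℝ (X.auxCost ρ - X.q) y := by
  simp [lagrangian, PiLp.inner_apply]

theorem lagrangian_sub_lagrangian (ρ : Measure (StationaryPolicy S A))
    (y z : EuclideanSpace ℝ (Fin K)) :
    X.lagrangian ρ y - X.lagrangian ρ z = inner ℝ (X.auxCost ρ - X.q) (y - z) := by
  rw [lagrangian_eq_cost_add_inner, lagrangian_eq_cost_add_inner, inner_sub_right]
  ring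

theorem lagrangian_le_cost {ρ : Measure (StationaryPolicy S A)}
    (hρ : ∀ k, X.auxCost ρ k ≤ X.q k) {y : EuclideanSpace ℝ (Fin K)} (hy : ∀ k, 0 ≤ y k) :
    X.lagrangian ρ y ≤ X.cost ρ :=
  add_le_of_nonpos_right <| Finset.sum_nonpos fun k _ =>
    mul_nonpos_of_nonneg_of_nonpos (hy k) (sub_nonpos.2 (hρ k))

/-- The pairs `(C(ρ), D(ρ) - q)` attained by mixing policies `ρ`. Over this set the constrained
problem becomes a convex program with linear objective and constraints. -/
def achievableValues (X : CMDP S A K) : Set (ℝ × EuclideanSpace ℝ (Fin K)) :=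
  (fun ρ => (X.cost ρ, X.auxCost ρ - X.q)) '' {ρ | IsProbabilityMeasure ρ}

variable [Countable A] [MeasurableSingletonClass A]

theorem lagrangian_eq_integral_occMix (h : X.BoundedCosts)
    (ρ : Measure (StationaryPolicy S A)) [IsProbabilityMeasure ρ]
    (y : EuclideanSpace ℝ (Fin K)) :
    X.lagrangian ρ y = ∫ x, X.modCost y x.1 x.2 ∂(X.occMix ρ) := by
  obtain ⟨Bc, hBc⟩ := h.exists_abs_c_le
  choose Bd hBd using h.exists_abs_d_le
  have hc : Integrable (fun x : S × A => X.c x.1 x.2) (X.occMix ρ) :=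
    integrable_of_abs_le fun x => hBc x.1 x.2
  have hd : ∀ k, Integrable (fun x : S × A => X.d k x.1 x.2) (X.occMix ρ) := fun k =>
    integrable_of_abs_le fun x => hBd k x.1 x.2
  have hdq : ∀ k, Integrable (fun x : S × A => y k * (X.d k x.1 x.2 - X.q k)) (X.occMix ρ) :=
    fun k => ((hd k).sub (integrable_const _)).const_mul _
  have hterm : ∀ k, ∫ x, y k * (X.d k x.1 x.2 - X.q k) ∂(X.occMix ρ) =
      y k * (X.auxCost ρ k - X.q k) := fun k => by
    rw [integral_const_mul, integral_sub (hd k) (integrable_const _), integral_const,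
      probReal_univ, one_smul, ← X.integral_discounted ρ (hBd k)]
    rfl
  simp only [modCost]
  rw [integral_add hc (integrable_finsetSum _ fun k _ => hdq k),
    integral_finsetSum _ fun k _ => hdq k, ← X.integral_discounted ρ hBc,
    Finset.sum_congr rfl fun k _ => hterm k]
  rfl

theorem lagrangian_eq_integral_discounted (h : X.BoundedCosts)
    (ρ : Measure (StationaryPolicy S A)) [IsProbabilityMeasure ρ]
    (y : EuclideanSpace ℝ (Fin K)) :
    X.lagrangian ρ y = ∫ π, X.discounted (X.modCost y) π (X.initLaw π) ∂ρ := by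
  obtain ⟨B, hB⟩ := h.exists_abs_modCost_le y
  rw [lagrangian_eq_integral_occMix h, X.integral_discounted _ hB]

theorem lagrangian_dirac (h : X.BoundedCosts) (π : StationaryPolicy S A)
    (y : EuclideanSpace ℝ (Fin K)) :
    X.lagrangian (Measure.dirac π) y = X.discounted (X.modCost y) π (X.initLaw π) := by
  rw [lagrangian_eq_integral_discounted h, integral_dirac]

theorem convex_achievableValues (h : X.BoundedCosts) : Convex ℝ X.achievableValues := by
  obtain ⟨Bc, hBc⟩ := h.exists_abs_c_le
  choose Bd hBd using h.exists_abs_d_le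
  rintro _ ⟨ρ, hρ, rfl⟩ _ ⟨ρ', hρ', rfl⟩ a b ha hb hab
  rw [Set.mem_ofPred_eq] at hρ hρ'
  refine ⟨ENNReal.ofReal a • ρ + ENNReal.ofReal b • ρ', ⟨?_⟩, ?_⟩
  · simp [← ENNReal.ofReal_add ha hb, hab]
  have haffine : ∀ {f : S → A → ℝ} {B : ℝ}, (∀ s a, |f s a| ≤ B) →
      ∫ π, X.discounted f π (X.initLaw π) ∂(ENNReal.ofReal a • ρ + ENNReal.ofReal b • ρ') =
        a * ∫ π, X.discounted f π (X.initLaw π) ∂ρ +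
          b * ∫ π, X.discounted f π (X.initLaw π) ∂ρ' := fun hf =>
    integral_ofReal_smul_add_ofReal_smul (X.integrable_discounted ρ hf)
      (X.integrable_discounted ρ' hf) ha hb
  refine Prod.ext (haffine hBc) (PiLp.ext fun k => ?_)
  have hk : X.auxCost (ENNReal.ofReal a • ρ + ENNReal.ofReal b • ρ') k =
      a * X.auxCost ρ k + b * X.auxCost ρ' k := haffine (hBd k)
  simp only [Prod.snd_add, Prod.smul_snd, PiLp.add_apply, PiLp.sub_apply, PiLp.smul_apply,
    smul_eq_mul, hk]
  linear_combination X.q k * hab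

theorem IsPrimalOptimal.exists_forall_cost_le_lagrangian (h : X.BoundedCosts)
    (hslater : X.Slater) {ρs : Measure (StationaryPolicy S A)} (hρs : X.IsPrimalOptimal ρs) :
    ∃ y : EuclideanSpace ℝ (Fin K), (∀ k, 0 ≤ y k) ∧
      ∀ ρ : Measure (StationaryPolicy S A), IsProbabilityMeasure ρ →
        X.cost ρs ≤ X.lagrangian ρ y := by
  have hconv := convex_achievableValues h
  obtain ⟨ρ₀, hρ₀, hlt⟩ := hslater
  obtain ⟨y, hy0, hy⟩ := exists_lagrange_multiplier (s := X.achievableValues) (f := Prod.fst)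
    (g := fun k v => v.2 k) (p := X.cost ρs)
    ((LinearMap.fst ℝ ℝ (EuclideanSpace ℝ (Fin K))).convexOn hconv)
    (fun k => ((EuclideanSpace.proj k).toLinearMap.comp
      (LinearMap.snd ℝ ℝ (EuclideanSpace ℝ (Fin K)))).convexOn hconv)
    ⟨_, ⟨ρ₀, hρ₀, rfl⟩, fun k => sub_neg.2 (hlt k)⟩
    (by
      rintro _ ⟨ρ, hρ, rfl⟩ hle
      exact hρs.2.2 ρ hρ fun k => sub_nonpos.1 (hle k))
  exact ⟨WithLp.toLp 2 y, hy0, fun ρ hρ => hy _ ⟨ρ, hρ, rfl⟩⟩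

theorem isSaddlePointOn_lagrangian (h : X.BoundedCosts) (hslater : X.Slater)
    {ρs : Measure (StationaryPolicy S A)} (hρs : X.IsPrimalOptimal ρs)
    {ls : EuclideanSpace ℝ (Fin K)} (hls : X.IsDualOptimal ls) :
    IsSaddlePointOn {ρ | IsProbabilityMeasure ρ} {y | ∀ k, 0 ≤ y k} X.lagrangian ρs ls := by
  intro ρ hρ y hy
  obtain ⟨ys, hys, hle⟩ := hρs.exists_forall_cost_le_lagrangian h hslater
  have hdual : (X.cost ρs : EReal) ≤ X.dualFun ls :=
    (le_iInf fun ρ' : ProbabilityMeasure (StationaryPolicy S A) =>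
      EReal.coe_le_coe_iff.2 (hle ρ' ρ'.2)).trans (hls.2 ys hys)
  exact (lagrangian_le_cost hρs.2.1 hy).trans <|
    EReal.coe_le_coe_iff.1 (hdual.trans (iInf_le _ (⟨ρ, hρ⟩ : ProbabilityMeasure _)))

end Lagrangian

section PositivePart

variable {ι : Type*}

/-- The coordinatewise positive part `[g]^+`; the constraint violation of a policy is the norm of
`[D - q]^+`. -/
def coordPosPart (g : EuclideanSpace ℝ ι) : EuclideanSpace ℝ ι :=
  WithLp.toLp 2 fun k => max (g k) 0

theorem coordPosPart_nonneg (g : EuclideanSpace ℝ ι) (k : ι) : 0 ≤ coordPosPart g k :=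
  le_max_right _ _

variable [Fintype ι]

theorem inner_coordPosPart_self (g : EuclideanSpace ℝ ι) :
    inner ℝ g (coordPosPart g) = ‖coordPosPart g‖ ^ 2 := by
  rw [EuclideanSpace.norm_sq_eq, PiLp.inner_apply]
  refine Finset.sum_congr rfl fun k _ => ?_
  rcases le_total (g k) 0 with hk | hk <;> simp [coordPosPart, hk, sq]

theorem inner_le_norm_coordPosPart_mul_norm (g : EuclideanSpace ℝ ι) {y : EuclideanSpace ℝ ι}
    (hy : ∀ k, 0 ≤ y k) : inner ℝ g y ≤ ‖coordPosPart g‖ * ‖y‖ := by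
  refine le_trans ?_ (real_inner_le_norm _ _)
  rw [PiLp.inner_apply, PiLp.inner_apply]
  exact Finset.sum_le_sum fun k _ => mul_le_mul_of_nonneg_left (le_max_left (g k) 0) (hy k)

end PositivePart

section DualDomain

variable {K : ℕ} {M r : ℝ}

theorem convex_dualDomain (K : ℕ) (M r : ℝ) : Convex ℝ (dualDomain K M r) := by
  intro x hx y hy a b ha hb hab
  refine ⟨fun k => add_nonneg (mul_nonneg ha (hx.1 k)) (mul_nonneg hb (hy.1 k)), ?_⟩
  have hball := convex_closedBall (0 : EuclideanSpace ℝ (Fin K)) (M + r)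
    (mem_closedBall_zero_iff.2 hx.2) (mem_closedBall_zero_iff.2 hy.2) ha hb hab
  exact mem_closedBall_zero_iff.1 hball

theorem norm_sub_sq_le_sqRadius (l₀ : EuclideanSpace ℝ (Fin K))
    {y : EuclideanSpace ℝ (Fin K)} (hy : y ∈ dualDomain K M r) :
    ‖y - l₀‖ ^ 2 ≤ sqRadius (dualDomain K M r) l₀ := by
  refine le_csSup ⟨(M + r + ‖l₀‖) ^ 2, ?_⟩ ⟨y, hy, rfl⟩
  rintro _ ⟨z, hz, rfl⟩
  exact pow_le_pow_left₀ (norm_nonneg _) ((norm_sub_le _ _).trans (add_le_add_left hz.2 _)) 2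

/-- The multiplier `z + r [g]^+ / ‖[g]^+‖` stays in the domain and detects the size of `[g]^+`:
this is why the domain has the margin `r`. -/
theorem exists_mem_dualDomain_inner_eq (hr : 0 ≤ r) {z : EuclideanSpace ℝ (Fin K)}
    (hz : ∀ k, 0 ≤ z k) (hzM : ‖z‖ ≤ M) (g : EuclideanSpace ℝ (Fin K)) :
    ∃ y ∈ dualDomain K M r, inner ℝ g y = inner ℝ g z + r * ‖coordPosPart g‖ := by
  set v := coordPosPart g with hv
  have hcoef : 0 ≤ r / ‖v‖ := div_nonneg hr (norm_nonneg v)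
  refine ⟨z + (r / ‖v‖) • v, ⟨fun k => ?_, ?_⟩, ?_⟩
  · exact add_nonneg (hz k) (mul_nonneg hcoef (coordPosPart_nonneg g k))
  · refine (norm_add_le _ _).trans (add_le_add hzM ?_)
    rw [norm_smul, Real.norm_of_nonneg hcoef]
    rcases eq_or_ne ‖v‖ 0 with hv0 | hv0
    · simpa [hv0] using hr
    · exact (div_mul_cancel₀ r hv0).le
  · rw [inner_add_right, real_inner_smul_right, hv, inner_coordPosPart_self, ← hv]
    rcases eq_or_ne ‖v‖ 0 with hv0 | _
    · simp [hv0]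
    · field_simp

end DualDomain

section Output

variable {S A : Type*} [MeasurableSpace A] {η : ℕ → ℝ} {T : ℕ}

theorem isProbabilityMeasure_output (hη : ∀ m, 0 ≤ η m) (hT : 0 < ∑ m ∈ Finset.range T, η m)
    (π : ℕ → StationaryPolicy S A) : IsProbabilityMeasure (output η π T) := by
  constructor
  simp only [output, Measure.coe_finsetSum, Finset.sum_apply, Measure.smul_apply, measure_univ,
    smul_eq_mul, mul_one]
  rw [← ENNReal.ofReal_sum_of_nonneg fun m _ => div_nonneg (hη m) hT.le, ← Finset.sum_div,
    div_self hT.ne', ENNReal.ofReal_one]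

variable [Countable S] [MeasurableSpace S] [MeasurableSingletonClass S]
  [Countable A] [MeasurableSingletonClass A] {K : ℕ} {X : CMDP S A K}

theorem sum_mul_lagrangian_output (h : X.BoundedCosts) (hη : ∀ m, 0 ≤ η m)
    (hT : 0 < ∑ m ∈ Finset.range T, η m) (π : ℕ → StationaryPolicy S A)
    (y : EuclideanSpace ℝ (Fin K)) :
    (∑ m ∈ Finset.range T, η m) * X.lagrangian (output η π T) y =
      ∑ m ∈ Finset.range T, η m * X.lagrangian (Measure.dirac (π m)) y := by
  obtain ⟨B, hB⟩ := h.exists_abs_modCost_le y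
  have := isProbabilityMeasure_output hη hT π
  rw [lagrangian_eq_integral_discounted h, output, integral_finsetSum_measure fun m _ =>
    (X.integrable_discounted _ hB).smul_measure ENNReal.ofReal_ne_top, Finset.mul_sum]
  refine Finset.sum_congr rfl fun m _ => ?_
  rw [integral_smul_measure, integral_dirac, lagrangian_dirac h,
    ENNReal.toReal_ofReal (div_nonneg (hη m) hT.le), smul_eq_mul, ← mul_assoc,
    mul_div_cancel₀ _ hT.ne']

end Output

section RegretBound

variable {S A : Type*} [Countable S] [MeasurableSpace S] [MeasurableSingletonClass S]
  [MeasurableSpace A] {K : ℕ}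

/-- The bound on the total regret of the first `T` steps of the algorithm: `b` is half the squared
distance from `l 0` to the comparison multiplier, the last summand is the regret of the policies
against the comparison policy `ρ`, and the rest is the regret of the multipliers. -/
def regretBound (X : CMDP S A K) (ρ : Measure (StationaryPolicy S A))
    (π₀ : StationaryPolicy S A) (G : ℝ) (η : ℕ → ℝ) (T : ℕ) (b : ℝ) : ℝ :=
  b + G ^ 2 / 2 * ∑ m ∈ Finset.range T, η m ^ 2 +
    ((X.potential ρ π₀).toReal + G ^ 2 / 2 * ∑ m ∈ Finset.range T, η m ^ 2) / (1 - X.γ)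

variable (X : CMDP S A K) (ρ : Measure (StationaryPolicy S A)) (π₀ : StationaryPolicy S A)

theorem regretBound_const (G η : ℝ) (T : ℕ) (b : ℝ) :
    X.regretBound ρ π₀ G (fun _ => η) T b = b + G ^ 2 / 2 * (T * η ^ 2) +
      ((X.potential ρ π₀).toReal + G ^ 2 / 2 * (T * η ^ 2)) / (1 - X.γ) := by
  simp only [regretBound, Finset.sum_const, Finset.card_range, nsmul_eq_mul]

theorem regretBound_le_div {G : ℝ} {η : ℕ → ℝ} {T : ℕ} {b N : ℝ} (hb : 0 ≤ b)
    (hN : G ^ 2 * ∑ m ∈ Finset.range T, η m ^ 2 ≤ N) :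
    X.regretBound ρ π₀ G η T b ≤ (b + N + (X.potential ρ π₀).toReal) / (1 - X.γ) := by
  have hE : 0 ≤ G ^ 2 / 2 * ∑ m ∈ Finset.range T, η m ^ 2 :=
    mul_nonneg (by positivity) (Finset.sum_nonneg fun m _ => sq_nonneg _)
  have hdiv : b + G ^ 2 / 2 * ∑ m ∈ Finset.range T, η m ^ 2 ≤
      (b + G ^ 2 / 2 * ∑ m ∈ Finset.range T, η m ^ 2) / (1 - X.γ) :=
    le_div_self (add_nonneg hb hE) X.one_sub_γ_pos (sub_le_self 1 X.γ_pos.le)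
  refine (add_le_add_left hdiv _).trans ?_
  rw [← add_div]
  exact div_le_div_of_nonneg_right (by linarith) X.one_sub_γ_pos.le

end RegretBound

section Run

variable {S A : Type*} [Countable S] [MeasurableSpace S] [MeasurableSingletonClass S]
  [MeasurableSpace A] {K : ℕ} {X : CMDP S A K}
  {Λ : Set (EuclideanSpace ℝ (Fin K))} {G : ℝ} {η : ℕ → ℝ} {π : ℕ → StationaryPolicy S A}
  {l : ℕ → EuclideanSpace ℝ (Fin K)}

theorem IsPrimalDualRun.mem (hrun : X.IsPrimalDualRun Λ η π l) : ∀ m, l m ∈ Λ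
  | 0 => hrun.init_mem
  | m + 1 => hrun.dual_mem m

theorem IsPrimalDualRun.sum_mul_lagrangian_sub_lagrangian_le
    (hrun : X.IsPrimalDualRun Λ η π l) (hΛ : Convex ℝ Λ) (hG : X.BoundedSubgradient Λ G)
    {y : EuclideanSpace ℝ (Fin K)} (hy : y ∈ Λ) (T : ℕ) :
    ∑ m ∈ Finset.range T, η m *
        (X.lagrangian (Measure.dirac (π m)) y - X.lagrangian (Measure.dirac (π m)) (l m)) ≤
      ‖y - l 0‖ ^ 2 / 2 + G ^ 2 / 2 * ∑ m ∈ Finset.range T, η m ^ 2 := by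
  simp only [lagrangian_sub_lagrangian]
  exact sum_mul_inner_sub_le_of_projection hΛ
    (fun m => ((hG _ (hrun.mem m)).2 _ inferInstance).1) hrun.dual_mem hrun.dual_proj hy T

variable [Countable A] [MeasurableSingletonClass A]

theorem IsPrimalDualRun.sum_mul_lagrangian_dirac_sub_le (hrun : X.IsPrimalDualRun Λ η π l)
    (hX : X.BoundedCosts) (hG : X.BoundedSubgradient Λ G)
    (ρ : Measure (StationaryPolicy S A)) [IsProbabilityMeasure ρ]
    (hΦ : X.potential ρ (π 0) ≠ ∞) (T : ℕ) :
    ∑ m ∈ Finset.range T,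
        η m * (X.lagrangian (Measure.dirac (π m)) (l m) - X.lagrangian ρ (l m)) ≤
      ((X.potential ρ (π 0)).toReal + G ^ 2 / 2 * ∑ m ∈ Finset.range T, η m ^ 2) /
        (1 - X.γ) := by
  simp only [lagrangian_dirac hX, lagrangian_eq_integral_occMix hX ρ]
  rw [le_div_iff₀' X.one_sub_γ_pos]
  exact X.sum_mul_discounted_sub_integral_occMix_le ρ
    (fun m => hX.exists_abs_modCost_le (l m)) (fun m => hG.abs_qFun_le (hrun.mem m) (π m))
    hrun.policy_step hΦ T

theorem IsPrimalDualRun.sum_mul_sub_le_regretBound (hrun : X.IsPrimalDualRun Λ η π l)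
    (hΛ : Convex ℝ Λ) (hX : X.BoundedCosts) (hG : X.BoundedSubgradient Λ G)
    (ρ : Measure (StationaryPolicy S A)) [IsProbabilityMeasure ρ]
    (hΦ : X.potential ρ (π 0) ≠ ∞) {y : EuclideanSpace ℝ (Fin K)} (hy : y ∈ Λ) (T : ℕ) :
    ∑ m ∈ Finset.range T, η m * (X.lagrangian (Measure.dirac (π m)) y - X.lagrangian ρ (l m)) ≤
      X.regretBound ρ (π 0) G η T (‖y - l 0‖ ^ 2 / 2) := by
  refine le_trans (le_of_eq ?_) (add_le_add
    (hrun.sum_mul_lagrangian_sub_lagrangian_le hΛ hG hy T)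
    (hrun.sum_mul_lagrangian_dirac_sub_le hX hG ρ hΦ T))
  rw [← Finset.sum_add_distrib]
  exact Finset.sum_congr rfl fun m _ => by ring

end Run

theorem le_mul_one_div_of_mul_le {H D x B : ℝ} (hD : 0 < D) (hDH : D ≤ H) (hB : 0 ≤ B)
    (h : H * x ≤ B) : x ≤ B * (1 / D) := by
  rw [mul_one_div]
  exact ((le_div_iff₀' (hD.trans_le hDH)).2 h).trans (div_le_div_of_nonneg_left hB hD hDH)

theorem sum_range_const_pos {x : ℝ} (hx : 0 < x) {T : ℕ} (hT : 1 ≤ T) :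
    0 < ∑ _m ∈ Finset.range T, x :=
  Finset.sum_pos (fun _ _ => hx) (Finset.nonempty_range_iff.2 (Nat.one_le_iff_ne_zero.1 hT))

namespace Setting

variable {S A : Type*} [Countable S] [MeasurableSpace S] [MeasurableSingletonClass S]
  [MeasurableSpace A] {K : ℕ} {X : CMDP S A K} {M r G : ℝ}
  {ρs : Measure (StationaryPolicy S A)} {ls : EuclideanSpace ℝ (Fin K)} {η : ℕ → ℝ}
  {π : ℕ → StationaryPolicy S A} {l : ℕ → EuclideanSpace ℝ (Fin K)}

theorem radius_pos (h : X.Setting M r G ρs ls η π l) : 0 < M + r :=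
  add_pos_of_nonneg_of_pos ((norm_nonneg _).trans h.norm_le) h.r_pos

variable [Countable A] [MeasurableSingletonClass A]

theorem boundedCosts (h : X.Setting M r G ρs ls η π l) : X.BoundedCosts :=
  h.bounded_subgradient.boundedCosts h.radius_pos h.bounded_below (π 0)

theorem isSaddlePointOn (h : X.Setting M r G ρs ls η π l) :
    IsSaddlePointOn {ρ | IsProbabilityMeasure ρ} {y | ∀ k, 0 ≤ y k} X.lagrangian ρs ls :=
  isSaddlePointOn_lagrangian h.boundedCosts h.slater h.primal_optimal h.dual_optimal

theorem lagrangian_optimal_le (h : X.Setting M r G ρs ls η π l)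
    {y : EuclideanSpace ℝ (Fin K)} (hy : ∀ k, 0 ≤ y k) :
    X.lagrangian ρs y ≤ X.lagrangian ρs ls :=
  h.isSaddlePointOn ρs h.primal_optimal.1 y hy

theorem le_lagrangian_optimal (h : X.Setting M r G ρs ls η π l)
    (ρ : Measure (StationaryPolicy S A)) [hρ : IsProbabilityMeasure ρ] :
    X.lagrangian ρs ls ≤ X.lagrangian ρ ls :=
  h.isSaddlePointOn ρ hρ ls h.dual_optimal.1

theorem neg_norm_mul_le_cost_sub (h : X.Setting M r G ρs ls η π l)
    {ρ : Measure (StationaryPolicy S A)} [IsProbabilityMeasure ρ] {v : ℝ}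
    (hv : X.violation ρ ≤ v) : -(‖ls‖ * v) ≤ X.cost ρ - X.lagrangian ρs ls := by
  have hsaddle := h.le_lagrangian_optimal ρ
  rw [lagrangian_eq_cost_add_inner ρ] at hsaddle
  have hinner : inner ℝ (X.auxCost ρ - X.q) ls ≤ X.violation ρ * ‖ls‖ :=
    inner_le_norm_coordPosPart_mul_norm _ h.dual_optimal.1
  linarith [mul_le_mul_of_nonneg_right hv (norm_nonneg ls)]

variable {T : ℕ}

theorem sum_mul_lagrangian_output_sub_le (h : X.Setting M r G ρs ls η π l)
    (hη : ∀ m, 0 ≤ η m) (hT : 0 < ∑ m ∈ Finset.range T, η m)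
    {y : EuclideanSpace ℝ (Fin K)} (hy : y ∈ dualDomain K M r) :
    (∑ m ∈ Finset.range T, η m) * (X.lagrangian (output η π T) y - X.lagrangian ρs ls) ≤
      X.regretBound ρs (π 0) G η T (‖y - l 0‖ ^ 2 / 2) := by
  have := h.primal_optimal.1
  refine le_trans ?_ (h.run.sum_mul_sub_le_regretBound (convex_dualDomain K M r) h.boundedCosts
    h.bounded_subgradient ρs h.finite_potential hy T)
  simp only [mul_sub, Finset.sum_sub_distrib, sum_mul_lagrangian_output h.boundedCosts hη hT,
    Finset.sum_mul]
  exact sub_le_sub_left (Finset.sum_le_sum fun m _ => mul_le_mul_of_nonneg_left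
    (h.lagrangian_optimal_le (h.run.mem m).1) (hη m)) _

theorem sum_mul_cost_output_sub_le (h : X.Setting M r G ρs ls η π l)
    (hη : ∀ m, 0 ≤ η m) (hT : 0 < ∑ m ∈ Finset.range T, η m) :
    (∑ m ∈ Finset.range T, η m) * (X.cost (output η π T) - X.lagrangian ρs ls) ≤
      X.regretBound ρs (π 0) G η T (‖l 0‖ ^ 2 / 2) := by
  have hzero := h.sum_mul_lagrangian_output_sub_le hη hT (zero_mem_dualDomain h.radius_pos.le)
  rwa [lagrangian_eq_cost_add_inner (output η π T), inner_zero_right, add_zero, zero_sub,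
    norm_neg] at hzero

theorem sum_mul_violation_output_le (h : X.Setting M r G ρs ls η π l)
    (hη : ∀ m, 0 ≤ η m) (hT : 0 < ∑ m ∈ Finset.range T, η m) :
    (∑ m ∈ Finset.range T, η m) * (r * X.violation (output η π T)) ≤
      X.regretBound ρs (π 0) G η T (sqRadius (dualDomain K M r) (l 0) / 2) := by
  have := isProbabilityMeasure_output hη hT π
  obtain ⟨y, hy, hinner⟩ := exists_mem_dualDomain_inner_eq h.r_pos.le h.dual_optimal.1 h.norm_le
    (X.auxCost (output η π T) - X.q)
  have hgain : r * X.violation (output η π T) ≤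
      X.lagrangian (output η π T) y - X.lagrangian ρs ls := by
    have hsplit := lagrangian_sub_lagrangian (X := X) (output η π T) y ls
    rw [inner_sub_right, hinner, add_sub_cancel_left] at hsplit
    exact hsplit.ge.trans (sub_le_sub_left (h.le_lagrangian_optimal _) _)
  calc (∑ m ∈ Finset.range T, η m) * (r * X.violation (output η π T))
      ≤ (∑ m ∈ Finset.range T, η m) *
          (X.lagrangian (output η π T) y - X.lagrangian ρs ls) :=
        mul_le_mul_of_nonneg_left hgain hT.le
    _ ≤ X.regretBound ρs (π 0) G η T (‖y - l 0‖ ^ 2 / 2) :=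
        h.sum_mul_lagrangian_output_sub_le hη hT hy
    _ ≤ X.regretBound ρs (π 0) G η T (sqRadius (dualDomain K M r) (l 0) / 2) := by
        unfold regretBound
        gcongr
        exact norm_sub_sq_le_sqRadius (l 0) hy

theorem violation_output_le_of_sum_bounds (h : X.Setting M r G ρs ls η π l)
    (hη : ∀ m, 0 ≤ η m) {D N : ℝ} (hD : 0 < D) (hDsum : 2 * D ≤ ∑ m ∈ Finset.range T, η m)
    (hN : G ^ 2 * ∑ m ∈ Finset.range T, η m ^ 2 ≤ N) :
    X.violation (output η π T) ≤ (sqRadius (dualDomain K M r) (l 0) + N +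
      (X.potential ρs (π 0)).toReal) * (1 / (2 * r * (1 - X.γ) * D)) := by
  have hr := h.r_pos
  have hγ := X.one_sub_γ_pos
  have hR : 0 ≤ sqRadius (dualDomain K M r) (l 0) :=
    (sq_nonneg _).trans (norm_sub_sq_le_sqRadius (l 0) h.run.init_mem)
  have hN0 : 0 ≤ N := (by positivity : 0 ≤ G ^ 2 * ∑ m ∈ Finset.range T, η m ^ 2).trans hN
  have hle := (h.sum_mul_violation_output_le hη (by linarith)).trans
    (X.regretBound_le_div ρs (π 0) (by positivity) hN)
  rw [le_div_iff₀' hγ, mul_left_comm, ← mul_assoc, ← mul_assoc] at hle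
  refine le_mul_one_div_of_mul_le (by positivity) ?_ (by positivity) (hle.trans (by linarith))
  calc 2 * r * (1 - X.γ) * D = 2 * D * (1 - X.γ) * r := by ring
    _ ≤ (∑ m ∈ Finset.range T, η m) * (1 - X.γ) * r := by gcongr

theorem cost_output_sub_le_of_sum_bounds (h : X.Setting M r G ρs ls η π l)
    (hη : ∀ m, 0 ≤ η m) {D N : ℝ} (hD : 0 < D) (hDsum : 2 * D ≤ ∑ m ∈ Finset.range T, η m)
    (hN : G ^ 2 * ∑ m ∈ Finset.range T, η m ^ 2 ≤ N) :
    X.cost (output η π T) - X.lagrangian ρs ls ≤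
      (N + (X.potential ρs (π 0)).toReal + ‖l 0‖ ^ 2 / 2) * (1 / ((1 - X.γ) * D)) := by
  have hγ := X.one_sub_γ_pos
  have hN0 : 0 ≤ N := (by positivity : 0 ≤ G ^ 2 * ∑ m ∈ Finset.range T, η m ^ 2).trans hN
  have hle := (h.sum_mul_cost_output_sub_le hη (by linarith)).trans
    (X.regretBound_le_div ρs (π 0) (by positivity) hN)
  rw [le_div_iff₀' hγ, ← mul_assoc] at hle
  refine le_mul_one_div_of_mul_le (by positivity) ?_ (by positivity) (hle.trans (by linarith))
  gcongr
  linarith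

theorem violation_output_const_le {η : ℝ} (h : X.Setting M r G ρs ls (fun _ => η) π l)
    (hη : 0 < η) (hT : 1 ≤ T) :
    X.violation (output (fun _ => η) π T) ≤
      (sqRadius (dualDomain K M r) (l 0) + 2 * (1 - X.γ)⁻¹ * (X.potential ρs (π 0)).toReal) *
        (1 / (2 * r * T * η)) + (1 + 1 / (1 - X.γ)) * (G ^ 2 * η / (2 * r)) := by
  have hr := h.r_pos
  have hγ := X.one_sub_γ_pos
  have hle := h.sum_mul_violation_output_le (fun _ => hη.le) (sum_range_const_pos hη hT)
  simp only [regretBound_const, Finset.sum_const, Finset.card_range, nsmul_eq_mul] at hle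
  rw [← mul_assoc, ← le_div_iff₀' (by positivity)] at hle
  refine hle.trans_eq ?_
  field_simp
  ring

theorem cost_output_const_sub_le {η : ℝ} (h : X.Setting M r G ρs ls (fun _ => η) π l)
    (hη : 0 < η) (hT : 1 ≤ T) :
    X.cost (output (fun _ => η) π T) - X.lagrangian ρs ls ≤
      ((1 - X.γ)⁻¹ * (X.potential ρs (π 0)).toReal + ‖l 0‖ ^ 2 / 2) * (1 / (T * η)) +
        (1 / 2 + 1 / (2 * (1 - X.γ))) * (G ^ 2 * η) := by
  have hγ := X.one_sub_γ_pos
  have hle := h.sum_mul_cost_output_sub_le (fun _ => hη.le) (sum_range_const_pos hη hT)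
  simp only [regretBound_const, Finset.sum_const, Finset.card_range, nsmul_eq_mul] at hle
  rw [← le_div_iff₀' (by positivity)] at hle
  refine hle.trans_eq ?_
  field_simp
  ring

end Setting

end

end CMDP

theorem theorem1 :
    -- step sizes of order `1 / √m`; `κ₁`, `κ₂` depend on the step sizes only
    (∀ η : ℕ → ℝ, (∀ m, 0 < η m) → (η =Θ[atTop] fun m : ℕ => 1 / √(m : ℝ)) →
      ∃ κ₁ κ₂ : ℝ, 0 < κ₁ ∧ 0 < κ₂ ∧
        ∀ (S A : Type*) [Countable S] [MeasurableSpace S] [MeasurableSingletonClass S]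
          [Countable A] [MeasurableSpace A] [MeasurableSingletonClass A] (K : ℕ)
          (X : CMDP S A K) (M r G : ℝ) (ρs : Measure (StationaryPolicy S A))
          (ls : EuclideanSpace ℝ (Fin K)) (π : ℕ → StationaryPolicy S A)
          (l : ℕ → EuclideanSpace ℝ (Fin K)),
          X.Setting M r G ρs ls η π l →
          ∀ T : ℕ, 2 ≤ T →
            X.violation (CMDP.output η π T) ≤
              (CMDP.sqRadius (CMDP.dualDomain K M r) (l 0) + 5 / 8 * G ^ 2 * κ₂ * Real.log T
                + (X.potential ρs (π 0)).toReal) * (1 / (2 * r * (1 - X.γ) * κ₁ * √(T : ℝ))) ∧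
            X.cost (CMDP.output η π T) - X.lagrangian ρs ls ≤
              (5 / 8 * G ^ 2 * κ₂ * Real.log T + (X.potential ρs (π 0)).toReal
                + ‖l 0‖ ^ 2 / 2) * (1 / ((1 - X.γ) * κ₁ * √(T : ℝ))) ∧
            X.cost (CMDP.output η π T) - X.lagrangian ρs ls ≥
              -(‖ls‖ * ((CMDP.sqRadius (CMDP.dualDomain K M r) (l 0)
                + 5 / 8 * G ^ 2 * κ₂ * Real.log T + (X.potential ρs (π 0)).toReal) *
                  (1 / (2 * r * (1 - X.γ) * κ₁ * √(T : ℝ)))))) ∧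
    -- constant step size
    (∀ (S A : Type*) [Countable S] [MeasurableSpace S] [MeasurableSingletonClass S]
      [Countable A] [MeasurableSpace A] [MeasurableSingletonClass A] (K : ℕ)
      (X : CMDP S A K) (M r G η : ℝ) (ρs : Measure (StationaryPolicy S A))
      (ls : EuclideanSpace ℝ (Fin K)) (π : ℕ → StationaryPolicy S A)
      (l : ℕ → EuclideanSpace ℝ (Fin K)),
      0 < η → X.Setting M r G ρs ls (fun _ => η) π l →
      ∀ T : ℕ, 1 ≤ T →
        X.violation (CMDP.output (fun _ => η) π T) ≤
          (CMDP.sqRadius (CMDP.dualDomain K M r) (l 0)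
            + 2 * (1 - X.γ)⁻¹ * (X.potential ρs (π 0)).toReal) * (1 / (2 * r * T * η))
            + (1 + 1 / (1 - X.γ)) * (G ^ 2 * η / (2 * r)) ∧
        X.cost (CMDP.output (fun _ => η) π T) - X.lagrangian ρs ls ≤
          ((1 - X.γ)⁻¹ * (X.potential ρs (π 0)).toReal + ‖l 0‖ ^ 2 / 2) * (1 / (T * η))
            + (1 / 2 + 1 / (2 * (1 - X.γ))) * (G ^ 2 * η) ∧
        X.cost (CMDP.output (fun _ => η) π T) - X.lagrangian ρs ls ≥
          -(‖ls‖ * ((CMDP.sqRadius (CMDP.dualDomain K M r) (l 0)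
            + 2 * (1 - X.γ)⁻¹ * (X.potential ρs (π 0)).toReal) * (1 / (2 * r * T * η))
            + (1 + 1 / (1 - X.γ)) * (G ^ 2 * η / (2 * r))))) := by
  refine ⟨fun η hη hΘ => ?_, fun S A _ _ _ _ _ _ K X M r G η ρs ls π l hη h T hT => ?_⟩
  · obtain ⟨κ₁, hκ₁, κ₂, hκ₂, hsums⟩ := exists_sum_bounds_of_isTheta_one_div_sqrt hη hΘ
    refine ⟨κ₁, κ₂, hκ₁, hκ₂, fun S A _ _ _ _ _ _ K X M r G ρs ls π l h T hT => ?_⟩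
    obtain ⟨hsum, hsqsum⟩ := hsums T hT
    have hη' : ∀ m, 0 ≤ η m := fun m => (hη m).le
    have hD : 0 < κ₁ * √(T : ℝ) := mul_pos hκ₁ (Real.sqrt_pos.2 (by positivity))
    have hN : G ^ 2 * ∑ m ∈ Finset.range T, η m ^ 2 ≤ 5 / 8 * G ^ 2 * κ₂ * Real.log T :=
      (mul_le_mul_of_nonneg_left hsqsum (sq_nonneg G)).trans_eq (by ring)
    have := CMDP.isProbabilityMeasure_output hη' ((mul_pos two_pos hD).trans_le hsum) π
    have hviolation := h.violation_output_le_of_sum_bounds hη' hD hsum hN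
    have hcost := h.cost_output_sub_le_of_sum_bounds hη' hD hsum hN
    rw [← mul_assoc] at hviolation hcost
    exact ⟨hviolation, hcost, h.neg_norm_mul_le_cost_sub hviolation⟩
  · have hviolation := h.violation_output_const_le hη hT
    have := CMDP.isProbabilityMeasure_output (fun _ => hη.le)
      (CMDP.sum_range_const_pos hη hT) π
    exact ⟨hviolation, h.cost_output_const_sub_le hη hT, h.neg_norm_mul_le_cost_sub hviolation⟩
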